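/- Conventions. A Boolean ring is a ring, not necessarily with an identity, in which $a^2=a$ for all $a$. The Stone space $X$ of a Boolean ring $R$ is the space of nonzero ring homomorphisms $\varphi\colon R\to\mathbb{F}_2$ with the topology generated by the sets $D(a)=\{\varphi\mid\varphi(a)=1\}$, $a\in R$; the $D(a)$ are exactly the compact open subsets of $X$, and an ideal $J$ of $R$ corresponds to the closed set $X\setminus\bigcup_{a\in J}D(a)$. "Countable" means finite or countably infinite. A countable first-order structure $M$ is $\omega$-categorical if every countable structure for the same language that is elementarily equivalent to $M$ is isomorphic to $M$; the system $(R,J_1,\dots,J_n)$ is viewed as a structure for the language of rings (without a symbol for the identity) with $n$ additional unary predicates. For $S\subseteq X$ write $S'$ for the derived set (the set of limit points) of $S$ and $\overline S$ for its closure. An isolated point of $S$ is an element of $S\setminus S'$, and $S$ is crowded if $S\subseteq S'$. For a family $\boldsymbol{C}$ of subsets of $X$, let $\langle\boldsymbol{C},{}^-\rangle$ (respectively $\langle\boldsymbol{C},{}'\rangle$) be the smallest Boolean subalgebra of $2^X$, containing $X$, that contains $\boldsymbol{C}$ and is closed under $S\mapsto\overline S$ (respectively $S\mapsto S'$). A partition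 of $X$ (into nonempty sets) is finite-crowded if it is finite and each of its elements is either finite or crowded. A PO system is a set $P$ with an antisymmetric transitive relation $<$ (so $p<p$ is allowed). A partition of $X$ is a complete $P$-partition if its elements can be labelled, bijectively, as $\{X_p\mid p\in P\}$ so that $X_p'=\bigcup_{q<p}X_q$ for all $p\in P$. A partition refines a family of subsets of $X$ if every member of the family is a union of elements of the partition. **Theorem.** Let $J_1,\dots,J_n$ be ideals of the countable Boolean ring $R$, corresponding to the closed subsets $C_1,\dots,C_n$ of the Stone space $X$ of $R$, and write $\boldsymbol{C}=\{C_1,\dots,C_n\}$. Then the following are equivalent: 1. $(R,J_1,\dots,J_n)$ is $\omega$-categorical; 2. $\langle\boldsymbol{C},{}^-\rangle$ is finite, and each of its atoms has only finitely many isolated points; 3. $\langle\boldsymbol{C},{}'\rangle$ is finite, and its atoms form a finite-crowded partition of $X$; 4. the atoms of $\langle\boldsymbol{C},{}'\rangle$ form a finite-crowded complete $P$-partition of $X$ for some finite PO system $P$; 5. there are a finite PO system $P$ and a finite-crowded complete $P$-partition of $X$ that refines $\boldsymbol{C}$. -/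

import Mathlib

universe u

/-! ### Countable categoricity -/

/-- A (countable) structure `M` is `ω`-categorical if it is determined up to isomorphism, within
the class of countable structures for the same language, by its first order properties.
Countable means finite or countably infinite. -/
def IsOmegaCategorical (L : FirstOrder.Language.{0, 0}) (M : Type u) [L.Structure M] : Prop :=
  ∀ (N : Type u) [L.Structure N] [Countable N],
    L.ElementarilyEquivalent M N → Nonempty (L.Equiv M N)

/-- Function symbols of the language of rings that need not have an identity. -/
inductive RngFunc : ℕ → Type
  | zero : RngFunc 0
  | neg : RngFunc 1
  | add : RngFunc 2
  | mul : RngFunc 2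

/-- Relation symbols: one unary predicate for each of the `n` distinguished ideals. -/
inductive IdealRel (n : ℕ) : ℕ → Type
  | ideal (i : Fin n) : IdealRel n 1

/-- The language of rings (possibly without identity) with `n` distinguished ideals. -/
def idealLanguage (n : ℕ) : FirstOrder.Language.{0, 0} where
  Functions := RngFunc
  Relations := IdealRel n

/-- The system `(R, J₁, …, Jₙ)` as a first order structure. -/
abbrev idealStructure {R : Type u} [NonUnitalRing R] {n : ℕ} (J : Fin n → TwoSidedIdeal R) :
    (idealLanguage n).Structure R where
  funMap {_} f :=
    match f with
    | RngFunc.zero => fun _ => 0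
    | RngFunc.neg => fun v => -v 0
    | RngFunc.add => fun v => v 0 + v 1
    | RngFunc.mul => fun v => v 0 * v 1
  RelMap {_} r :=
    match r with
    | IdealRel.ideal i => fun v => v 0 ∈ J i

/-- `ω`-categoricity of the system `(R, J₁, …, Jₙ)`. -/
def IsOmegaCategoricalSystem {R : Type u} [NonUnitalRing R] {n : ℕ}
    (J : Fin n → TwoSidedIdeal R) : Prop :=
  letI := idealStructure J
  IsOmegaCategorical (idealLanguage n) R

/-! ### The Stone space of a Boolean ring -/

/-- The points of the Stone space of a Boolean ring `R` (possibly without identity): the nonzero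
ring homomorphisms from `R` to the field with two elements. Their kernels are exactly the
proper prime ideals of `R`. -/
def StoneSpace (R : Type u) [NonUnitalRing R] : Type u :=
  {φ : R →ₙ+* ZMod 2 // φ ≠ 0}

/-- The compact open set of the Stone space that corresponds to the element `a` of `R`. -/
def StoneSpace.basicOpen {R : Type u} [NonUnitalRing R] (a : R) : Set (StoneSpace R) :=
  {φ | φ.1 a = 1}

instance StoneSpace.instTopologicalSpace {R : Type u} [NonUnitalRing R] :
    TopologicalSpace (StoneSpace R) :=
  TopologicalSpace.generateFrom (Set.range StoneSpace.basicOpen)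

/-- The closed subset of the Stone space that corresponds to the ideal `J`: the complement of the
union of the compact open sets that belong to `J`. -/
def StoneSpace.closedSet {R : Type u} [NonUnitalRing R] (J : TwoSidedIdeal R) :
    Set (StoneSpace R) :=
  (⋃ a ∈ J, StoneSpace.basicOpen a)ᶜ

/-! ### Subalgebras of the power set of a topological space -/

section Topology

variable {X : Type u}

/-- The smallest Boolean subalgebra of the power set of `X` that contains `A` and is closed under
the operator `op`. -/
def generatedSubalgebra (op : Set X → Set X) (A : Set (Set X)) : BooleanSubalgebra (Set X) :=
  sInf {D | A ⊆ (D : Set (Set X)) ∧ ∀ S ∈ D, op S ∈ D}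

/-- The closure subalgebra of the power set of `X` generated by `A`. -/
def closureSubalgebra [TopologicalSpace X] (A : Set (Set X)) : BooleanSubalgebra (Set X) :=
  generatedSubalgebra closure A

/-- The sub-TBA (topological Boolean algebra, with the derived set operator) of the power set of
`X` generated by `A`. -/
def derivedSubalgebra [TopologicalSpace X] (A : Set (Set X)) : BooleanSubalgebra (Set X) :=
  generatedSubalgebra derivedSet A

/-- The set of atoms of a Boolean subalgebra of the power set of `X`. -/
def atomSet (D : BooleanSubalgebra (Set X)) : Set (Set X) :=
  {S | ∃ h : S ∈ D, IsAtom (⟨S, h⟩ : D)}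

variable [TopologicalSpace X]

/-- The isolated points of a subset `S`, that is, the points of `S` that are isolated in the
subspace topology of `S`. -/
def isolatedPoints (S : Set X) : Set X :=
  S \ derivedSet S

/-- A set is crowded if it has no isolated points. -/
def IsCrowded (S : Set X) : Prop :=
  S ⊆ derivedSet S

/-- A finite-crowded partition of `X`: a finite partition into (nonempty) sets each of which is
finite or crowded. -/
def IsFiniteCrowdedPartition (𝒳 : Set (Set X)) : Prop :=
  Setoid.IsPartition 𝒳 ∧ 𝒳.Finite ∧ ∀ S ∈ 𝒳, S.Finite ∨ IsCrowded S

end Topology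

/-! ### PO systems and complete partitions -/

/-- A PO system: a set with an antisymmetric transitive relation (not required to be reflexive
or irreflexive). -/
structure POSystem (P : Type) where
  lt : P → P → Prop
  trans : ∀ p q r, lt p q → lt q r → lt p r
  antisymm : ∀ p q, lt p q → lt q p → p = q

/-- `𝒳` is a complete `P`-partition of `X`: a partition that can be labelled (bijectively) as
`{X_p | p ∈ P}` such that the derived set of `X_p` is the union of the `X_q` with `q < p`. -/
def IsCompletePartition {X : Type u} [TopologicalSpace X] {P : Type} (po : POSystem P)
    (𝒳 : Set (Set X)) : Prop :=
  Setoid.IsPartition 𝒳 ∧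
    ∃ f : P → Set X, Function.Injective f ∧ Set.range f = 𝒳 ∧
      ∀ p, derivedSet (f p) = ⋃ (q : P) (_ : po.lt q p), f q

/-- The partition `𝒳` refines the family `C`: each `C i` is a union of elements of `𝒳`. -/
def PartitionRefines {X : Type u} {ι : Type} (𝒳 : Set (Set X)) (C : ι → Set X) : Prop :=
  ∀ i, ∃ 𝒬 ⊆ 𝒳, C i = ⋃₀ 𝒬

/-!
# Countably categorical Boolean rings with distinguished ideals

The implications `1 → 2 → 3 → 4 → 5 → 1` are proved in this cyclic order.

*From categoricity to finiteness.* In a countable `ω`-categorical structure only finitely many sets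
are definable without parameters (`IsOmegaCategorical.finite_definable`). Indeed every type that is
finitely satisfiable in the structure is realized in some countable elementarily equivalent
structure, hence in the structure itself; so isolated tuples are dense, a generic union of them is
an elementary substructure isomorphic to the whole, hence all tuples are isolated, and compactness
applies once more. For a Boolean ring, the ideals that correspond to the closed sets of the closure
algebra are definable, and so is the relation "`D(a)` has at most `k` points in `S`". Therefore the
closure algebra is finite and its members have finitely many isolated points.

*Topology.* Separating the finitely many isolated points from each atom of the closure algebra
gives a finite-crowded partition whose unions are closed under derived sets. The atoms of the
derived algebra are ordered by `B < A` if `B ⊆ A'`; antisymmetry holds because the derived algebra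
is generated as a Boolean algebra by its closed members, so that two atoms with the same closure
coincide (`exists_isCompletePartition_atomSet`).

*From a complete partition to categoricity.* Attach to a tuple of ring elements the number of points
of each type `p` (that is, in `X_p`) in each cell of the Boolean algebra generated by the tuple. As
the parts are finite or crowded, this invariant has finitely many values. It determines which
atomic formulas hold, and it has the back-and-forth property: if two open sets have the same number
of points of each type, then a splitting of one can be imitated in the other
(`IsFiniteCrowdedFamily.exists_split`). So tuples with equal invariants satisfy the same formulas,
there are finitely many formulas up to equivalence in each number of variables, and the structure
is `ω`-categorical (`isOmegaCategorical_of_invariant`). Since the invariants compare tuples of the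
given ring only, the partition need not be transported to another model.
-/

open FirstOrder FirstOrder.Language

/-! ### Countable categoricity and definable sets -/

namespace IsOmegaCategorical

variable {L : FirstOrder.Language.{0, 0}} {M : Type u} [L.Structure M]

/-- A sequence of formulas that is finitely satisfiable in a countable `ω`-categorical structure is
realized in that structure: it is realized in an ultrapower, so in a countable elementary
substructure of the ultrapower, which is isomorphic to the given structure. -/
theorem exists_forall_realize [Countable L.Symbols] [Countable M] (h : IsOmegaCategorical L M)
    {α : Type} [Countable α] (φ : ℕ → L.Formula α)
    (hφ : ∀ k, ∃ v : α → M, ∀ j ≤ k, (φ j).Realize v) : ∃ v : α → M, ∀ j, (φ j).Realize v := by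
  choose x hx using hφ
  rcases isEmpty_or_nonempty M with hM | hM
  · exact ⟨x 0, fun j => by rw [Subsingleton.elim (x 0) (x j)]; exact hx j j le_rfl⟩
  let U : Ultrafilter ℕ := Filter.hyperfilter ℕ
  let N := (U : Filter ℕ).Product fun _ => M
  let y : α → N := fun i => ((fun k => x k i : ℕ → M) : (U : Filter ℕ).Product fun _ => M)
  have hy : ∀ j, (φ j).Realize y := fun j => by
    refine (Ultraproduct.realize_formula_cast (φ j) (fun i k => x k i)).2 ?_
    have : ∀ᶠ k in Filter.hyperfilter ℕ, j ≤ k :=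
      Nat.hyperfilter_le_atTop (Filter.eventually_ge_atTop j)
    exact this.mono fun k hk => hx k j hk
  have hMN : L.ElementarilyEquivalent M N :=
    elementarilyEquivalent_iff.2 fun σ => by
      rw [Ultraproduct.sentence_realize]
      simp
  have key : ∀ (K : Type u) [L.Structure K] [Countable K], L.ElementarilyEquivalent M K →
      ∀ z : α → K, (∀ j, (φ j).Realize z) → ∃ v : α → M, ∀ j, (φ j).Realize v := by
    intro K _ _ hK z hz
    obtain ⟨f⟩ := h K hK
    exact ⟨f.symm ∘ z, fun j => (StrongHomClass.realize_formula f.symm (φ j)).2 (hz j)⟩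
  by_cases hN : Countable N
  · exact key N hMN y hy
  · obtain ⟨S, hyS, hS⟩ := exists_elementarySubstructure_card_eq.{0, 0, u, 0} L (Set.range y)
      Cardinal.aleph0 le_rfl (by simpa using (Set.countable_range y).le_aleph0)
      (by simpa [Language.card] using Cardinal.mk_le_aleph0 (α := L.Symbols))
      (by
        rw [not_iff_not.2 Cardinal.mk_le_aleph0_iff.symm, not_le] at hN
        simpa using hN.le)
    have hSc : Countable S := by
      rw [← Cardinal.mk_le_aleph0_iff]
      simpa using hS.le
    refine key S (hMN.trans S.elementarilyEquivalent.symm)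
      (fun i => ⟨y i, hyS ⟨i, rfl⟩⟩) fun j => ?_
    rw [← S.subtype.map_formula]
    exact hy j

/-- A compactness property of `ω`-categorical structures: a sequence of definable sets with the
finite intersection property has a common point in the structure itself. -/
theorem exists_forall_mem [Countable L.Symbols] [Countable M] (h : IsOmegaCategorical L M)
    {α : Type} [Countable α] (S : ℕ → Set (α → M)) (hS : ∀ k, (∅ : Set M).Definable L (S k))
    (hne : ∀ k, ∃ v, ∀ j ≤ k, v ∈ S j) : ∃ v, ∀ j, v ∈ S j := by
  choose φ hφ using fun k => Set.empty_definable_iff.1 (hS k)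
  simp only [hφ] at hne ⊢
  exact h.exists_forall_realize φ hne

end IsOmegaCategorical

/-- A tuple of a structure is isolated if there is a smallest `∅`-definable set containing it,
that is, if its complete type is isolated. -/
def IsIsolatedTuple (L : FirstOrder.Language.{0, 0}) {M : Type u} [L.Structure M] {n : ℕ}
    (a : Fin n → M) : Prop :=
  ∃ T : Set (Fin n → M), (∅ : Set M).Definable L T ∧ a ∈ T ∧
    ∀ U : Set (Fin n → M), (∅ : Set M).Definable L U → a ∈ U → T ⊆ U

section Isolated

variable {L : FirstOrder.Language.{0, 0}} {M : Type u} [L.Structure M]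

theorem definable_setOf_boundedFormula {n : ℕ} (φ : L.BoundedFormula Empty n) :
    (∅ : Set M).Definable L {x : Fin n → M | φ.Realize default x} := by
  rw [Set.empty_definable_iff]
  refine ⟨φ.toFormula.relabel (Sum.elim Empty.elim id), ?_⟩
  ext x
  rw [Set.mem_ofPred_eq, Set.mem_ofPred_eq, Formula.realize_relabel, BoundedFormula.realize_toFormula]
  exact iff_of_eq (congrArg₂ _ (Subsingleton.elim _ _) rfl)

/-- Isolated tuples are dense. Otherwise each definable subset of `T` can be shrunk to avoid any
given tuple; avoiding all tuples one after the other contradicts compactness. -/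
theorem IsOmegaCategorical.exists_isIsolatedTuple [Countable L.Symbols] [Countable M]
    (h : IsOmegaCategorical L M) {n : ℕ} {T : Set (Fin n → M)} (hT : (∅ : Set M).Definable L T)
    (hne : T.Nonempty) : ∃ a ∈ T, IsIsolatedTuple L a := by
  by_contra! hcon
  let D := {U : Set (Fin n → M) // (∅ : Set M).Definable L U ∧ U.Nonempty ∧ U ⊆ T}
  have step : ∀ (U : D) (c : Fin n → M), ∃ V : D, V.1 ⊆ U.1 ∧ c ∉ V.1 := by
    rintro ⟨U, hU, hUne, hUT⟩ c
    by_cases hc : c ∈ U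
    · have := hcon c (hUT hc)
      unfold IsIsolatedTuple at this
      push Not at this
      obtain ⟨V, hV, hcV, hUV⟩ := this U hU hc
      exact ⟨⟨U \ V, hU.sdiff hV, Set.sdiff_nonempty.2 hUV, Set.sdiff_subset.trans hUT⟩,
        Set.sdiff_subset, fun h => h.2 hcV⟩
    · exact ⟨⟨U, hU, hUne, hUT⟩, subset_rfl, hc⟩
  choose next hsub hnot using step
  have : Nonempty (Fin n → M) := ⟨hne.some⟩
  obtain ⟨e, he⟩ := exists_surjective_nat (Fin n → M)
  let s : ℕ → D := fun k => Nat.rec ⟨T, hT, hne, subset_rfl⟩ (fun k U => next U (e k)) k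
  have hs : ∀ k, (s (k + 1)).1 ⊆ (s k).1 := fun k => hsub _ _
  have hanti : Antitone fun k => (s k).1 := antitone_nat_of_succ_le hs
  obtain ⟨v, hv⟩ := h.exists_forall_mem (fun k => (s k).1) (fun k => (s k).2.1) fun k =>
    ⟨(s k).2.2.1.some, fun j hj => hanti hj (s k).2.2.1.some_mem⟩
  obtain ⟨k, rfl⟩ := he v
  exact hnot _ _ (hv (k + 1))

theorem Fin.snoc_comp_castSucc_eq {α : Type*} {n : ℕ} (a : Fin n → α) (c : α) :
    (Fin.snoc a c : Fin (n + 1) → α) ∘ Fin.castSucc = a := by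
  ext i; simp

theorem IsOmegaCategorical.exists_isIsolatedTuple_snoc [Countable L.Symbols] [Countable M]
    (h : IsOmegaCategorical L M) {n : ℕ} {a : Fin n → M} (ha : IsIsolatedTuple L a)
    {T : Set (Fin (n + 1) → M)} (hT : (∅ : Set M).Definable L T) {c : M}
    (hc : (Fin.snoc a c : Fin (n + 1) → M) ∈ T) :
    ∃ d : M, (Fin.snoc a d : Fin (n + 1) → M) ∈ T ∧
      IsIsolatedTuple L (Fin.snoc a d : Fin (n + 1) → M) := by
  obtain ⟨A, hA, haA, hAmin⟩ := ha
  obtain ⟨b, ⟨hbT, hbA⟩, B, hB, hbB, hBmin⟩ := h.exists_isIsolatedTuple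
    (hT.inter (hA.preimage_comp Fin.castSucc))
    ⟨_, hc, by simpa [Fin.snoc_comp_castSucc_eq] using haA⟩
  have hproj : a ∈ (fun g : Fin (n + 1) → M => g ∘ Fin.castSucc) '' B := by
    by_contra hcon
    have := hAmin _ (hB.image_comp Fin.castSucc).compl hcon hbA
    exact this ⟨b, hbB, rfl⟩
  obtain ⟨g, hgB, rfl⟩ := hproj
  have hg : (Fin.snoc (g ∘ Fin.castSucc) (g (Fin.last n)) : Fin (n + 1) → M) = g :=
    Fin.snoc_init_self g
  refine ⟨g (Fin.last n), ?_, ?_⟩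
  · rw [hg]
    exact hBmin T hT hbT hgB
  · rw [hg]
    refine ⟨B, hB, hgB, fun U hU hgU => ?_⟩
    by_contra hcon
    have hbU : b ∉ U := fun hbU => hcon (hBmin U hU hbU)
    exact hBmin _ hU.compl hbU hgB hgU

variable (L M) in
/-- The isolated tuples of a structure, ordered by inclusion of their ranges. -/
def IsolatedTuple : Type u :=
  Σ n : ℕ, {a : Fin n → M // IsIsolatedTuple L a}

instance : Preorder (IsolatedTuple L M) where
  le s t := Set.range s.2.1 ⊆ Set.range t.2.1
  le_refl _ := subset_rfl
  le_trans _ _ _ := Set.Subset.trans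

theorem Order.Ideal.exists_range_subset {P : Type*} [Preorder P] (I : Order.Ideal P) {X : Type*}
    (f : P → Set X) (hf : Monotone f) {k : ℕ} (x : Fin k → X)
    (hx : ∀ i, ∃ s ∈ I, x i ∈ f s) : ∃ s ∈ I, Set.range x ⊆ f s := by
  choose s hsI hxs using hx
  obtain ⟨z, hz, hle⟩ : ∃ z ∈ I, ∀ i ∈ Finset.univ, s i ≤ z := by
    classical
    refine Finset.induction_on (Finset.univ : Finset (Fin k)) ?_ ?_
    · exact ⟨I.nonempty.some, I.nonempty.some_mem, by simp⟩
    · rintro i t - ⟨z, hz, hle⟩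
      obtain ⟨w, hw, h1, h2⟩ := I.directed z hz (s i) (hsI i)
      refine ⟨w, hw, fun j hj => ?_⟩
      rcases Finset.mem_insert.1 hj with rfl | hj
      · exact h2
      · exact (hle j hj).trans h1
  exact ⟨z, hz, Set.range_subset_iff.2 fun i => hf (hle i (Finset.mem_univ i)) (hxs i)⟩

/-- An `ω`-categorical structure has an elementary substructure all of whose tuples are isolated.
It is the union of a generic ideal of isolated tuples; genericity yields the Tarski-Vaught
criterion. -/
theorem IsOmegaCategorical.exists_atomic_elementarySubstructure [Countable L.Symbols]
    [Countable M] (h : IsOmegaCategorical L M) :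
    ∃ N : L.ElementarySubstructure M, ∀ (n : ℕ) (a : Fin n → N),
      IsIsolatedTuple L (fun i => (a i : M)) := by
  let ι := Σ k : ℕ, L.BoundedFormula Empty (k + 1) × (Fin k → M)
  have hcount : ∀ k, Countable (L.BoundedFormula Empty k) := fun k =>
    Function.Injective.countable (f := fun φ => (⟨k, φ⟩ : Σ k, L.BoundedFormula Empty k))
      sigma_mk_injective
  have : Countable ι := inferInstance
  let _ : Encodable ι := Encodable.ofCountable ι
  let f : IsolatedTuple L M → Set M := fun s => Set.range s.2.1
  have hf : Monotone f := fun _ _ h => h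
  let sat : ι → M → Prop := fun i c => i.2.1.Realize default (Fin.snoc i.2.2 c : Fin (i.1 + 1) → M)
  -- A condition decides `i` if it contains a witness, or cannot be extended to the parameters.
  let 𝒟 : ι → Order.Cofinal (IsolatedTuple L M) := fun i =>
    { carrier := {s | (∃ c ∈ f s, sat i c) ∨ (∀ t, s ≤ t → ¬ Set.range i.2.2 ⊆ f t) ∨
        ∀ c, ¬ sat i c}
      isCofinal := by
        intro s
        by_cases hs : ∀ t, s ≤ t → ¬ Set.range i.2.2 ⊆ f t
        · exact ⟨s, Or.inr (Or.inl hs), le_rfl⟩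
        by_cases hc : ∀ c, ¬ sat i c
        · exact ⟨s, Or.inr (Or.inr hc), le_rfl⟩
        push Not at hs hc
        obtain ⟨⟨m, a, ha⟩, hst, hit⟩ := hs
        obtain ⟨c, hc⟩ := hc
        obtain ⟨k, φ, x⟩ := i
        have hit : Set.range x ⊆ Set.range a := hit
        choose g hg using fun j => hit (Set.mem_range_self j)
        obtain rfl : a ∘ g = x := funext hg
        let e : Fin (k + 1) → Fin (m + 1) := Fin.snoc (Fin.castSucc ∘ g) (Fin.last m)
        have he : ∀ d : M, (Fin.snoc a d : Fin (m + 1) → M) ∘ e =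
            (Fin.snoc (a ∘ g) d : Fin (k + 1) → M) := fun d => by
          funext j
          refine Fin.lastCases ?_ (fun j => ?_) j <;> simp [e]
        obtain ⟨d, hd, hiso⟩ := h.exists_isIsolatedTuple_snoc ha
          ((definable_setOf_boundedFormula φ).preimage_comp e) (c := c) (by
            simpa [he] using hc)
        refine ⟨⟨m + 1, _, hiso⟩, Or.inl ⟨d, ⟨Fin.last m, by simp⟩, ?_⟩, hst.trans ?_⟩
        · simpa [he] using hd
        · rintro _ ⟨j, rfl⟩
          exact ⟨j.castSucc, by simp⟩ }
  let p : IsolatedTuple L M := ⟨0, Fin.elim0, Set.univ, Set.definable_univ, trivial,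
    fun U _ hU v _ => by rwa [Subsingleton.elim v Fin.elim0]⟩
  let I := Order.idealOfCofinals p 𝒟
  let S : Set M := {c | ∃ s ∈ I, c ∈ f s}
  have htv : ∀ (k : ℕ) (φ : L.BoundedFormula Empty (k + 1)) (x : Fin k → M), (∀ i, x i ∈ S) →
      ∀ c : M, φ.Realize default (Fin.snoc x c : Fin (k + 1) → M) →
        ∃ d ∈ S, φ.Realize default (Fin.snoc x d : Fin (k + 1) → M) := by
    intro k φ x hx c hc
    obtain ⟨t, htI, ht⟩ := I.exists_range_subset f hf x hx
    obtain ⟨s, hs, hsI⟩ := Order.cofinal_meets_idealOfCofinals p 𝒟 ⟨k, φ, x⟩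
    rcases hs with ⟨d, hd, hsat⟩ | hs | hs
    · exact ⟨d, ⟨s, hsI, hd⟩, hsat⟩
    · obtain ⟨r, -, hsr, htr⟩ := I.directed s hsI t htI
      exact absurd (ht.trans (hf htr)) (hs r hsr)
    · exact absurd hc (hs c)
  let N : L.Substructure M :=
    { carrier := S
      fun_mem := by
        intro k F x hx
        obtain ⟨d, hd, hsat⟩ := htv k
          (Term.bdEqual (func F fun i => Term.var (Sum.inr i.castSucc))
            (Term.var (Sum.inr (Fin.last k)))) x hx (Structure.funMap F x) (by
              simp [BoundedFormula.realize_bdEqual, Term.realize])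
        have : Structure.funMap F x = d := by
          simpa [BoundedFormula.realize_bdEqual, Term.realize] using hsat
        rwa [this] }
  refine ⟨N.toElementarySubstructure fun k φ x c hc => ?_, fun n a => ?_⟩
  · obtain ⟨d, hd, hsat⟩ := htv k φ (fun i => x i) (fun i => (x i).2) c hc
    exact ⟨⟨d, hd⟩, hsat⟩
  · obtain ⟨⟨m, b, T, hT, hbT, hTmin⟩, -, ht⟩ :=
      I.exists_range_subset f hf (fun i => (a i : M)) fun i => (a i).2
    choose g hg using fun j => ht (Set.mem_range_self j)
    have hg' : b ∘ g = fun i => (a i : M) := funext hg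
    refine ⟨_, hT.image_comp g, ⟨b, hbT, hg'⟩, fun U hU haU => ?_⟩
    rintro _ ⟨v, hv, rfl⟩
    exact hTmin _ (hU.preimage_comp g) (by simpa [hg'] using haU) hv

/-- All tuples are isolated, since the structure is isomorphic to an elementary substructure whose
tuples are isolated. -/
theorem IsOmegaCategorical.isIsolatedTuple [Countable L.Symbols] [Countable M]
    (h : IsOmegaCategorical L M) {n : ℕ} (a : Fin n → M) : IsIsolatedTuple L a := by
  obtain ⟨N, hN⟩ := h.exists_atomic_elementarySubstructure
  obtain ⟨f⟩ := h N N.elementarilyEquivalent.symm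
  obtain ⟨T, hT, haT, hTmin⟩ := hN n (f ∘ a)
  have key : ∀ U : Set (Fin n → M), (∅ : Set M).Definable L U →
      (a ∈ U ↔ (fun i => ((f ∘ a) i : M)) ∈ U) := by
    intro U hU
    obtain ⟨φ, rfl⟩ := Set.empty_definable_iff.1 hU
    have h1 := StrongHomClass.realize_formula f φ (v := a)
    have h2 := N.subtype.map_formula φ (f ∘ a)
    exact h1.symm.trans h2.symm
  exact ⟨T, hT, (key T hT).2 haT, fun U hU haU => hTmin U hU ((key U hU).1 haU)⟩

/-- In a countable `ω`-categorical structure there are only finitely many `∅`-definable sets of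
`n`-tuples. -/
theorem IsOmegaCategorical.finite_definable [Countable L.Symbols] [Countable M]
    (h : IsOmegaCategorical L M) (n : ℕ) :
    {S : Set (Fin n → M) | (∅ : Set M).Definable L S}.Finite := by
  rcases isEmpty_or_nonempty (Fin n → M) with hM | hM
  · exact Set.toFinite _
  choose T hT haT hTmin using fun a : Fin n → M => h.isIsolatedTuple a
  obtain ⟨e, he⟩ := exists_surjective_nat (Fin n → M)
  obtain ⟨k, hk⟩ : ∃ k, ∀ v, ∃ j ≤ k, v ∈ T (e j) := by
    by_contra! hcon
    obtain ⟨v, hv⟩ := h.exists_forall_mem (fun j => (T (e j))ᶜ) (fun j => (hT _).compl) hcon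
    obtain ⟨j, rfl⟩ := he v
    exact hv j (haT _)
  refine Set.Finite.of_finite_image (f := fun S => {j : Fin (k + 1) | e j ∈ S}) (Set.toFinite _) ?_
  have key : ∀ S S' : Set (Fin n → M), (∅ : Set M).Definable L S → (∅ : Set M).Definable L S' →
      {j : Fin (k + 1) | e j ∈ S} = {j : Fin (k + 1) | e j ∈ S'} → S ⊆ S' := by
    intro S S' hS hS' hSS' v hv
    obtain ⟨j, hj, hvj⟩ := hk v
    have h1 : e j ∈ S := by
      by_contra hcon
      exact hTmin _ _ hS.compl hcon hvj hv
    have h2 : (⟨j, Nat.lt_succ_of_le hj⟩ : Fin (k + 1)) ∈ {j : Fin (k + 1) | e j ∈ S'} :=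
      hSS' ▸ h1
    exact hTmin _ _ hS' h2 hvj
  exact fun S hS S' hS' hSS' => (key S S' hS hS' hSS').antisymm (key S' S hS' hS hSS'.symm)

end Isolated

/-! ### Back-and-forth -/

section BackAndForth

variable {L : FirstOrder.Language.{0, 0}}

/-- Two tuples, possibly in different structures, have the same type. -/
def SameType (L : FirstOrder.Language.{0, 0}) {M N : Type u} [L.Structure M] [L.Structure N]
    {n : ℕ} (a : Fin n → M) (b : Fin n → N) : Prop :=
  ∀ φ : L.BoundedFormula Empty n, φ.Realize default a ↔ φ.Realize default b

/-- The sets of `n`-tuples defined by formulas without parameters are finite in number. -/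
def FinitelyManyFormulas (L : FirstOrder.Language.{0, 0}) (M : Type u) [L.Structure M] (n : ℕ) :
    Prop :=
  (Set.range fun φ : L.BoundedFormula Empty n => {x : Fin n → M | φ.Realize default x}).Finite

variable {M N : Type u} [L.Structure M] [L.Structure N]

theorem SameType.symm {n : ℕ} {a : Fin n → M} {b : Fin n → N} (h : SameType L a b) :
    SameType L b a := fun φ => (h φ).symm

theorem FirstOrder.Language.ElementarilyEquivalent.forall_realize_iff
    (h : L.ElementarilyEquivalent M N) {n : ℕ} (φ : L.BoundedFormula Empty n) :
    (∀ x : Fin n → M, φ.Realize default x) ↔ ∀ x : Fin n → N, φ.Realize default x := by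
  rw [← BoundedFormula.realize_alls, ← BoundedFormula.realize_alls]
  exact h.realize_sentence φ.alls

theorem FinitelyManyFormulas.of_elementarilyEquivalent {n : ℕ}
    (h : L.ElementarilyEquivalent M N) (hM : FinitelyManyFormulas L M n) :
    FinitelyManyFormulas L N n := by
  classical
  have key : ∀ φ ψ : L.BoundedFormula Empty n,
      {x : Fin n → M | φ.Realize default x} = {x : Fin n → M | ψ.Realize default x} →
      {x : Fin n → N | φ.Realize default x} = {x : Fin n → N | ψ.Realize default x} := by
    intro φ ψ hφψ
    have h1 : ∀ x : Fin n → M, (φ.iff ψ).Realize default x := fun x => by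
      rw [BoundedFormula.realize_iff]
      exact Set.ext_iff.1 hφψ x
    ext x
    have h2 := (h.forall_realize_iff (φ.iff ψ)).1 h1 x
    rwa [BoundedFormula.realize_iff] at h2
  -- Choosing a formula for each set definable in `M` bounds the number of sets definable in `N`.
  let F : Set (Fin n → M) → Set (Fin n → N) := fun S =>
    if hS : ∃ φ : L.BoundedFormula Empty n, {x : Fin n → M | φ.Realize default x} = S then
      {x : Fin n → N | hS.choose.Realize default x} else ∅
  refine (hM.image F).subset ?_
  rintro _ ⟨φ, rfl⟩
  refine ⟨_, ⟨φ, rfl⟩, ?_⟩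
  have hS : ∃ ψ : L.BoundedFormula Empty n,
    {x : Fin n → M | ψ.Realize default x} = {x : Fin n → M | φ.Realize default x} := ⟨φ, rfl⟩
  simp only [F]
  rw [dif_pos hS]
  exact key _ _ hS.choose_spec

theorem FinitelyManyFormulas.exists_isolating {n : ℕ} (hM : FinitelyManyFormulas L M n)
    (a : Fin n → M) : ∃ θ : L.BoundedFormula Empty n, θ.Realize default a ∧
      ∀ χ : L.BoundedFormula Empty n, χ.Realize default a →
        ∀ x : Fin n → M, θ.Realize default x → χ.Realize default x := by
  have hfin : (Set.range (fun φ : L.BoundedFormula Empty n =>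
      {x : Fin n → M | φ.Realize default x}) ∩ {S | a ∈ S}).Finite := hM.inter_of_left _
  have : ∀ 𝒮 : Set (Set (Fin n → M)), 𝒮.Finite → 𝒮 ⊆ (Set.range (fun φ : L.BoundedFormula Empty n =>
      {x : Fin n → M | φ.Realize default x}) ∩ {S | a ∈ S}) →
      ∃ θ : L.BoundedFormula Empty n, θ.Realize default a ∧
        ∀ S ∈ 𝒮, ∀ x, θ.Realize default x → x ∈ S := by
    intro 𝒮 h𝒮
    induction 𝒮, h𝒮 using Set.Finite.induction_on with
    | empty => exact fun _ => ⟨⊤, by simp, by simp⟩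
    | @insert S 𝒮 _ _ ih =>
      intro hsub
      obtain ⟨θ, hθa, hθ⟩ := ih ((Set.subset_insert _ _).trans hsub)
      obtain ⟨⟨ψ, rfl⟩, hψa⟩ := hsub (Set.mem_insert _ _)
      refine ⟨θ ⊓ ψ, BoundedFormula.realize_inf.2 ⟨hθa, hψa⟩, fun S hS x hx => ?_⟩
      rw [BoundedFormula.realize_inf] at hx
      rcases hS with rfl | hS
      · exact hx.2
      · exact hθ S hS x hx.1
  obtain ⟨θ, hθa, hθ⟩ := this _ hfin subset_rfl
  exact ⟨θ, hθa, fun χ hχ x hx => hθ _ ⟨⟨χ, rfl⟩, hχ⟩ x hx⟩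

theorem SameType.exists_snoc (h : L.ElementarilyEquivalent M N) {n : ℕ}
    (hM : FinitelyManyFormulas L M (n + 1)) {a : Fin n → M} {b : Fin n → N}
    (hab : SameType L a b) (c : M) :
    ∃ d : N, SameType L (Fin.snoc a c : Fin (n + 1) → M) (Fin.snoc b d : Fin (n + 1) → N) := by
  obtain ⟨θ, hθ, hmin⟩ := hM.exists_isolating (Fin.snoc a c : Fin (n + 1) → M)
  obtain ⟨d, hd⟩ := BoundedFormula.realize_ex.1
    ((hab θ.ex).1 (BoundedFormula.realize_ex.2 ⟨c, hθ⟩))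
  have key : ∀ χ : L.BoundedFormula Empty (n + 1),
      χ.Realize default (Fin.snoc a c : Fin (n + 1) → M) →
        χ.Realize default (Fin.snoc b d : Fin (n + 1) → N) := by
    intro χ hχ
    have h1 : ∀ x : Fin (n + 1) → M, (θ.imp χ).Realize default x := fun x =>
      BoundedFormula.realize_imp.2 (hmin χ hχ x)
    exact BoundedFormula.realize_imp.1 ((h.forall_realize_iff (θ.imp χ)).1 h1 _) hd
  refine ⟨d, fun χ => ⟨key χ, fun hχ => ?_⟩⟩
  by_contra hcon
  exact BoundedFormula.realize_not.1 (key χ.not (BoundedFormula.realize_not.2 hcon)) hχ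

variable (L M N) in
/-- Pairs of tuples of the same type in two structures, ordered by inclusion of the
correspondences that they define. -/
def SameTypePair : Type u :=
  Σ n : ℕ, {p : (Fin n → M) × (Fin n → N) // SameType L p.1 p.2}

/-- The finite correspondence between `M` and `N` given by a pair of tuples. -/
def SameTypePair.graph (s : SameTypePair L M N) : Set (M × N) :=
  Set.range fun i => (s.2.1.1 i, s.2.1.2 i)

instance : Preorder (SameTypePair L M N) where
  le s t := s.graph ⊆ t.graph
  le_refl _ := subset_rfl
  le_trans _ _ _ := Set.Subset.trans

theorem SameTypePair.exists_le (s : SameTypePair L M N) (c : M) (d : N)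
    (h : SameType L (Fin.snoc s.2.1.1 c : Fin (s.1 + 1) → M)
      (Fin.snoc s.2.1.2 d : Fin (s.1 + 1) → N)) : ∃ t, (c, d) ∈ t.graph ∧ s ≤ t := by
  refine ⟨⟨s.1 + 1, ((Fin.snoc s.2.1.1 c : Fin (s.1 + 1) → M),
    (Fin.snoc s.2.1.2 d : Fin (s.1 + 1) → N)), h⟩, ⟨Fin.last _, by simp⟩, ?_⟩
  rintro _ ⟨i, rfl⟩
  exact ⟨i.castSucc, by simp⟩

/-- Half of the Ryll-Nardzewski theorem: a structure in which only finitely many sets of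
`n`-tuples are definable, for each `n`, is `ω`-categorical. Complete types are then isolated, and
the pairs of tuples of the same type form a back-and-forth system. -/
theorem isOmegaCategorical_of_finitelyManyFormulas [Countable M]
    (hM : ∀ n, FinitelyManyFormulas L M n) : IsOmegaCategorical L M := by
  intro N _ _ hMN
  let ι := M ⊕ N
  let _ : Encodable ι := Encodable.ofCountable ι
  let 𝒟 : ι → Order.Cofinal (SameTypePair L M N) := fun i =>
    { carrier := {s | i.elim (fun c => ∃ d, (c, d) ∈ s.graph) fun d => ∃ c, (c, d) ∈ s.graph}
      isCofinal := by
        intro s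
        rcases i with c | d
        · obtain ⟨d, hd⟩ := s.2.2.exists_snoc hMN (hM _) c
          obtain ⟨t, ht, hst⟩ := s.exists_le c d hd
          exact ⟨t, ⟨d, ht⟩, hst⟩
        · obtain ⟨c, hc⟩ := s.2.2.symm.exists_snoc hMN.symm
            ((hM _).of_elementarilyEquivalent hMN) d
          obtain ⟨t, ht, hst⟩ := s.exists_le c d hc.symm
          exact ⟨t, ⟨c, ht⟩, hst⟩ }
  let p : SameTypePair L M N := ⟨0, (Fin.elim0, Fin.elim0), fun φ => by
    have h := hMN.realize_sentence φ
    rw [Sentence.Realize, Sentence.Realize, Formula.Realize, Formula.Realize] at h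
    rwa [Subsingleton.elim (Fin.elim0 : Fin 0 → M) default,
      Subsingleton.elim (Fin.elim0 : Fin 0 → N) default]⟩
  let I := Order.idealOfCofinals p 𝒟
  have hgraph : Monotone (SameTypePair.graph : SameTypePair L M N → Set (M × N)) :=
    fun _ _ h => h
  -- Finitely many pairs of the generic correspondence lie in a single condition.
  have key : ∀ (k : ℕ) (x : Fin k → M) (y : Fin k → N),
      (∀ i, ∃ s ∈ I, (x i, y i) ∈ s.graph) → SameType L x y := by
    intro k x y hxy
    obtain ⟨⟨n, ⟨a, b⟩, hab⟩, -, hs⟩ := I.exists_range_subset _ hgraph (fun i => (x i, y i)) hxy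
    have hs : ∀ i, ∃ j, (a j, b j) = (x i, y i) := fun i => hs (Set.mem_range_self i)
    choose g hg using hs
    obtain rfl : a ∘ g = x := funext fun i => (Prod.ext_iff.1 (hg i)).1
    obtain rfl : b ∘ g = y := funext fun i => (Prod.ext_iff.1 (hg i)).2
    intro φ
    have hφ : ∀ {K : Type u} [L.Structure K] (z : Fin n → K),
        BoundedFormula.Realize (BoundedFormula.relabel (Sum.inr : Fin n → Empty ⊕ Fin n)
          (Formula.relabel (Sum.elim Empty.elim g) φ.toFormula)) default z ↔
        φ.Realize default (z ∘ g) := fun z => by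
      refine (Formula.realize_relabel_sumInr _).trans ?_
      rw [Formula.realize_relabel, BoundedFormula.realize_toFormula]
      exact iff_of_eq (congrArg₂ _ (Subsingleton.elim _ _) rfl)
    exact ((hφ a).symm.trans (hab _)).trans (hφ b)
  have hfun : ∀ c : M, ∃ d, ∃ s ∈ I, (c, d) ∈ s.graph := fun c => by
    obtain ⟨s, ⟨d, hd⟩, hs⟩ := Order.cofinal_meets_idealOfCofinals p 𝒟 (Sum.inl c)
    exact ⟨d, s, hs, hd⟩
  have hinv : ∀ d : N, ∃ c, ∃ s ∈ I, (c, d) ∈ s.graph := fun d => by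
    obtain ⟨s, ⟨c, hc⟩, hs⟩ := Order.cofinal_meets_idealOfCofinals p 𝒟 (Sum.inr d)
    exact ⟨c, s, hs, hc⟩
  choose f hf using hfun
  choose g hg using hinv
  have hrel : ∀ c d c' d', (∃ s ∈ I, (c, d) ∈ s.graph) → (∃ s ∈ I, (c', d') ∈ s.graph) →
      (c = c' ↔ d = d') := by
    intro c d c' d' h h'
    have := key 2 ![c, c'] ![d, d'] (Fin.forall_fin_two.2 ⟨h, h'⟩)
      (Term.bdEqual (Term.var (Sum.inr 0)) (Term.var (Sum.inr 1)))
    simpa [BoundedFormula.realize_bdEqual, Term.realize] using this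
  refine ⟨{ toFun := f, invFun := g, left_inv := fun c => ?_, right_inv := fun d => ?_,
            map_fun' := fun {k} F x => ?_, map_rel' := fun {k} r x => ?_ }⟩
  · exact (hrel _ _ _ _ (hg (f c)) (hf c)).2 rfl
  · exact (hrel _ _ _ _ (hf (g d)) (hg d)).1 rfl
  · have := key (k + 1) (Fin.snoc x (Structure.funMap F x))
      (Fin.snoc (f ∘ x) (f (Structure.funMap F x)))
      (fun i => by refine Fin.lastCases ?_ (fun j => ?_) i <;> simp [hf])
      (Term.bdEqual (func F fun i => Term.var (Sum.inr i.castSucc))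
        (Term.var (Sum.inr (Fin.last k))))
    simp [BoundedFormula.realize_bdEqual, Term.realize] at this
    exact this.symm
  · have := key k x (f ∘ x) (fun i => hf _)
      (r.boundedFormula fun i => Term.var (Sum.inr i))
    simpa [BoundedFormula.realize_rel, Term.realize, Function.comp_def] using this.symm

/-- Tuples with equal invariants satisfy the same formulas, provided that the invariants decide
atomic formulas and have the back-and-forth property. Hence invariants with finitely many values
leave room for finitely many definable sets only. -/
theorem isOmegaCategorical_of_invariant [Countable M] {V : ℕ → Type*}
    (inv : ∀ k, (Fin k → M) → V k) (hfin : ∀ k, (Set.range (inv k)).Finite)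
    (hext : ∀ (k : ℕ) (a b : Fin k → M), inv k a = inv k b → ∀ c, ∃ d,
      inv (k + 1) (Fin.snoc a c) = inv (k + 1) (Fin.snoc b d))
    (heq : ∀ (k : ℕ) (a b : Fin k → M), inv k a = inv k b → ∀ t₁ t₂ : L.Term (Fin k),
      t₁.realize a = t₂.realize a → t₁.realize b = t₂.realize b)
    (hrel : ∀ (k : ℕ) (a b : Fin k → M), inv k a = inv k b → ∀ (l : ℕ) (r : L.Relations l)
      (t : Fin l → L.Term (Fin k)), Structure.RelMap r (fun i => (t i).realize a) →
        Structure.RelMap r (fun i => (t i).realize b)) : IsOmegaCategorical L M := by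
  have key : ∀ (k : ℕ) (φ : L.BoundedFormula Empty k) (a b : Fin k → M), inv k a = inv k b →
      (φ.Realize default a ↔ φ.Realize default b) := by
    intro k φ
    have hterm : ∀ {k : ℕ} (t : L.Term (Empty ⊕ Fin k)) (a : Fin k → M),
        t.realize (Sum.elim default a) = (t.relabel (Sum.elim Empty.elim id)).realize a := by
      intro k t a
      rw [Term.realize_relabel]
      congr 1
      ext i
      rcases i with i | i
      · exact i.elim
      · rfl
    induction φ with
    | falsum => exact fun _ _ _ => Iff.rfl
    | equal t₁ t₂ =>
      intro a b hab
      simp only [BoundedFormula.Realize, hterm]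
      exact ⟨heq _ a b hab _ _, heq _ b a hab.symm _ _⟩
    | rel r ts =>
      intro a b hab
      simp only [BoundedFormula.Realize, hterm]
      exact ⟨hrel _ a b hab _ r _, hrel _ b a hab.symm _ r _⟩
    | imp φ ψ ihφ ihψ =>
      intro a b hab
      simp only [BoundedFormula.realize_imp, ihφ a b hab, ihψ a b hab]
    | all φ ih =>
      intro a b hab
      simp only [BoundedFormula.realize_all]
      constructor
      · intro h d
        obtain ⟨c, hc⟩ := hext _ b a hab.symm d
        exact (ih _ _ hc).2 (h c)
      · intro h c
        obtain ⟨d, hd⟩ := hext _ a b hab c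
        exact (ih _ _ hd).2 (h d)
  refine isOmegaCategorical_of_finitelyManyFormulas fun n => ?_
  refine Set.Finite.of_finite_image (f := fun S => inv n '' S)
    ((hfin n).finite_subsets.subset ?_) ?_
  · rintro _ ⟨S, -, rfl⟩
    exact Set.image_subset_range _ _
  · have : ∀ φ ψ : L.BoundedFormula Empty n,
        inv n '' {x | φ.Realize default x} = inv n '' {x | ψ.Realize default x} →
        {x : Fin n → M | φ.Realize default x} ⊆ {x | ψ.Realize default x} := by
      intro φ ψ h x hx
      obtain ⟨y, hy, hyx⟩ := h ▸ Set.mem_image_of_mem (inv n) hx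
      exact (key n ψ y x hyx).1 hy
    rintro _ ⟨φ, rfl⟩ _ ⟨ψ, rfl⟩ h
    exact (this φ ψ h).antisymm (this ψ φ h.symm)

end BackAndForth

/-! ### Boolean rings and their Stone spaces -/

namespace StoneSpace

section BooleanRing

variable {R : Type u} [NonUnitalRing R]

theorem add_self_eq_zero (hR : ∀ a : R, a * a = a) (a : R) : a + a = 0 := by
  have h := hR (a + a)
  rw [mul_add, add_mul, hR] at h
  simpa using h

theorem mul_comm_of_idempotent (hR : ∀ a : R, a * a = a) (a b : R) : a * b = b * a := by
  have h := hR (a + b)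
  rw [mul_add, add_mul, add_mul, hR, hR] at h
  have h' : a * b + b * a = 0 := by
    have : a + b + (a * b + b * a) = a + b + 0 := by rw [add_zero]; nth_rewrite 2 [← h]; abel
    exact add_left_cancel this
  calc a * b = a * b + (b * a + b * a) := by rw [add_self_eq_zero hR, add_zero]
    _ = b * a := by rw [← add_assoc, h', zero_add]

theorem zmod_two_cases (x : ZMod 2) : x = 0 ∨ x = 1 := by
  revert x; decide

@[simp] theorem mem_basicOpen {a : R} {φ : StoneSpace R} : φ ∈ basicOpen a ↔ φ.1 a = 1 := Iff.rfl

theorem apply_eq_zero_iff {a : R} {φ : StoneSpace R} : φ.1 a = 0 ↔ φ ∉ basicOpen a := by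
  rw [mem_basicOpen]
  rcases zmod_two_cases (φ.1 a) with h | h <;> simp [h]

theorem basicOpen_mul (a b : R) : basicOpen (a * b) = basicOpen a ∩ basicOpen b := by
  ext φ
  simp only [mem_basicOpen, Set.mem_inter_iff, map_mul]
  generalize φ.1 a = x; generalize φ.1 b = y
  revert x y; decide

theorem basicOpen_add_mul (a b : R) : basicOpen (a + a * b) = basicOpen a \ basicOpen b := by
  ext φ
  simp only [mem_basicOpen, Set.mem_sdiff, map_mul, map_add]
  generalize φ.1 a = x; generalize φ.1 b = y
  revert x y; decide

theorem basicOpen_sup (a b : R) : basicOpen (a + b + a * b) = basicOpen a ∪ basicOpen b := by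
  ext φ
  simp only [mem_basicOpen, Set.mem_union, map_mul, map_add]
  generalize φ.1 a = x; generalize φ.1 b = y
  revert x y; decide

theorem basicOpen_zero : basicOpen (0 : R) = ∅ := by
  ext φ; simp

theorem exists_mem_basicOpen (φ : StoneSpace R) : ∃ a : R, φ ∈ basicOpen a := by
  by_contra! h
  exact φ.2 (DFunLike.ext _ _ fun a => apply_eq_zero_iff.2 (h a))

theorem isOpen_basicOpen (a : R) : IsOpen (basicOpen a) :=
  TopologicalSpace.isOpen_generateFrom_of_mem ⟨a, rfl⟩

theorem isTopologicalBasis_basicOpen :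
    TopologicalSpace.IsTopologicalBasis (Set.range (basicOpen : R → Set (StoneSpace R))) where
  exists_subset_inter := by
    rintro _ ⟨a, rfl⟩ _ ⟨b, rfl⟩ φ hφ
    exact ⟨_, ⟨a * b, rfl⟩, by rwa [basicOpen_mul], (basicOpen_mul a b).subset⟩
  sUnion_eq := Set.eq_univ_of_forall fun φ =>
    let ⟨a, ha⟩ := exists_mem_basicOpen φ
    ⟨_, ⟨a, rfl⟩, ha⟩
  eq_generateFrom := rfl

theorem isClosed_basicOpen (a : R) : IsClosed (basicOpen a) := by
  rw [← isOpen_compl_iff, isOpen_iff_mem_nhds]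
  intro φ hφ
  obtain ⟨b, hb⟩ := exists_mem_basicOpen φ
  refine Filter.mem_of_superset ((isOpen_basicOpen (b + b * a)).mem_nhds ?_) ?_
  · rw [basicOpen_add_mul]; exact ⟨hb, hφ⟩
  · rw [basicOpen_add_mul]; exact fun _ h => h.2

instance : T2Space (StoneSpace R) := by
  refine ⟨fun φ ψ hne => ?_⟩
  obtain ⟨a, ha⟩ : ∃ a, φ.1 a ≠ ψ.1 a := by
    by_contra! h
    exact hne (Subtype.ext (DFunLike.ext _ _ h))
  rcases zmod_two_cases (φ.1 a) with h | h
  · have h' : ψ.1 a = 1 := (zmod_two_cases _).resolve_left fun h' => ha (h.trans h'.symm)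
    exact ⟨(basicOpen a)ᶜ, basicOpen a, (isClosed_basicOpen a).isOpen_compl, isOpen_basicOpen a,
      apply_eq_zero_iff.1 h, h', disjoint_compl_left⟩
  · have h' : ψ.1 a = 0 := (zmod_two_cases _).resolve_right fun h' => ha (h.trans h'.symm)
    exact ⟨basicOpen a, (basicOpen a)ᶜ, isOpen_basicOpen a, (isClosed_basicOpen a).isOpen_compl,
      h, apply_eq_zero_iff.1 h', disjoint_compl_right⟩

/-- An ultrafilter containing `basicOpen a` converges to the homomorphism that records which
basic open sets it contains. -/
theorem isCompact_basicOpen (a : R) : IsCompact (basicOpen a) := by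
  classical
  rw [isCompact_iff_ultrafilter_le_nhds]
  intro U hU
  rw [Filter.le_principal_iff] at hU
  have hU : basicOpen a ∈ U := hU
  have key : ∀ b : R, ∀ᶠ φ in (U : Filter (StoneSpace R)),
      φ.1 b = if basicOpen b ∈ U then 1 else 0 := by
    intro b
    split_ifs with h
    · exact h
    · exact Filter.mem_of_superset (Ultrafilter.compl_mem_iff_notMem.2 h)
        fun φ hφ => apply_eq_zero_iff.2 hφ
  let φ : R →ₙ+* ZMod 2 :=
    { toFun := fun b => if basicOpen b ∈ U then 1 else 0
      map_mul' := fun b c => by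
        obtain ⟨ψ, hb, hc, hbc⟩ := ((key b).and ((key c).and (key (b * c)))).exists
        rw [← hb, ← hc, ← hbc, map_mul]
      map_zero' := by
        obtain ⟨ψ, h⟩ := (key 0).exists
        rw [← h, map_zero]
      map_add' := fun b c => by
        obtain ⟨ψ, hb, hc, hbc⟩ := ((key b).and ((key c).and (key (b + c)))).exists
        rw [← hb, ← hc, ← hbc, map_add] }
  have hφa : φ a = 1 := if_pos hU
  refine ⟨⟨φ, fun h => by simp [h] at hφa⟩, hφa, ?_⟩
  intro V hV
  obtain ⟨_, ⟨b, rfl⟩, hb, hbV⟩ := isTopologicalBasis_basicOpen.mem_nhds_iff.1 hV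
  refine Filter.mem_of_superset ?_ hbV
  by_contra hcon
  have : φ b = 0 := if_neg hcon
  have h1 : φ b = 1 := hb
  rw [this] at h1
  exact absurd h1 (by decide)

theorem exists_basicOpen_subset {K U : Set (StoneSpace R)} (hK : IsCompact K) (hU : IsOpen U)
    (hKU : K ⊆ U) : ∃ a : R, K ⊆ basicOpen a ∧ basicOpen a ⊆ U := by
  refine hK.induction_on (p := fun K => ∃ a : R, K ⊆ basicOpen a ∧ basicOpen a ⊆ U) ?_ ?_ ?_ ?_
  · exact ⟨0, Set.empty_subset _, by rw [basicOpen_zero]; exact Set.empty_subset _⟩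
  · rintro s t hst ⟨a, ha, haU⟩
    exact ⟨a, hst.trans ha, haU⟩
  · rintro s t ⟨a, ha, haU⟩ ⟨b, hb, hbU⟩
    refine ⟨a + b + a * b, ?_, ?_⟩
    · rw [basicOpen_sup]; exact Set.union_subset_union ha hb
    · rw [basicOpen_sup]; exact Set.union_subset haU hbU
  · intro x hx
    obtain ⟨_, ⟨a, rfl⟩, hxa, haU⟩ :=
      isTopologicalBasis_basicOpen.exists_subset_of_mem_open (hKU hx) hU
    exact ⟨_, mem_nhdsWithin_of_mem_nhds ((isOpen_basicOpen a).mem_nhds hxa), a, subset_rfl, haU⟩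

theorem exists_eq_basicOpen {K : Set (StoneSpace R)} (hK : IsCompact K) (hK' : IsOpen K) :
    ∃ a : R, K = basicOpen a :=
  let ⟨a, h, h'⟩ := exists_basicOpen_subset hK hK' subset_rfl
  ⟨a, h.antisymm h'⟩

/-- The prime ideal theorem for Boolean rings: an ideal that is maximal among those avoiding `a`
contains exactly one of `a * x` and `a + a * x` for each `x`, so membership of `a * x` defines a
homomorphism to the field with two elements. -/
theorem exists_mem_basicOpen_forall_notMem (hR : ∀ a : R, a * a = a) (J : TwoSidedIdeal R) {a : R}
    (ha : a ∉ J) : ∃ φ ∈ basicOpen a, ∀ b ∈ J, φ ∉ basicOpen b := by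
  classical
  have hcomm := mul_comm_of_idempotent hR
  have hself := add_self_eq_zero hR
  let IsId : Set R → Prop := fun I =>
    0 ∈ I ∧ (∀ x ∈ I, ∀ y ∈ I, x + y ∈ I) ∧ ∀ x ∈ I, ∀ y, y * x ∈ I
  obtain ⟨I, hJI, ⟨⟨h0, hadd, hmul⟩, haI⟩, hmax⟩ := zorn_subset_nonempty
    {I : Set R | IsId I ∧ a ∉ I} (by
      intro c hc hchain ⟨I₀, hI₀⟩
      refine ⟨⋃₀ c, ⟨⟨⟨I₀, hI₀, (hc hI₀).1.1⟩, ?_, ?_⟩, ?_⟩, fun s hs => Set.subset_sUnion_of_mem hs⟩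
      · rintro x ⟨s, hs, hx⟩ y ⟨t, ht, hy⟩
        rcases hchain.total hs ht with h | h
        · exact ⟨t, ht, (hc ht).1.2.1 x (h hx) y hy⟩
        · exact ⟨s, hs, (hc hs).1.2.1 x hx y (h hy)⟩
      · rintro x ⟨s, hs, hx⟩ y
        exact ⟨s, hs, (hc hs).1.2.2 x hx y⟩
      · rintro ⟨s, hs, hx⟩
        exact (hc hs).2 hx)
    {x | x ∈ J} ⟨⟨J.zero_mem, fun x hx y hy => J.add_mem hx hy,
      fun x hx y => J.mul_mem_left y x hx⟩, ha⟩
  -- Enlarging `I` by `a * x` or by `a + a * x` would capture `a`.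
  have key : ∀ x, a * x ∈ I ∨ a + a * x ∈ I := by
    intro x
    by_contra! hcon
    have h1 : a + a * x ∈ {z | ∃ i ∈ I, ∃ r, z = i + r * (a + a * x)} :=
      ⟨0, h0, a + a * x, by rw [hR, zero_add]⟩
    have hId : IsId {z | ∃ i ∈ I, ∃ r, z = i + r * (a + a * x)} := by
      refine ⟨⟨0, h0, 0, by simp⟩, ?_, ?_⟩
      · rintro _ ⟨i, hi, r, rfl⟩ _ ⟨j, hj, s, rfl⟩
        exact ⟨i + j, hadd i hi j hj, r + s, by rw [add_mul]; abel⟩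
      · rintro _ ⟨i, hi, r, rfl⟩ y
        exact ⟨y * i, hmul i hi y, y * r, by rw [mul_add, mul_assoc]⟩
    have hsub : I ⊆ {z | ∃ i ∈ I, ∃ r, z = i + r * (a + a * x)} := fun i hi => ⟨i, hi, 0, by simp⟩
    by_cases haI' : a ∈ {z | ∃ i ∈ I, ∃ r, z = i + r * (a + a * x)}
    · obtain ⟨i, hi, r, hr⟩ := haI'
      apply hcon.1
      have h2 : (a + a * x) * (a * x) = 0 := by
        rw [add_mul, ← mul_assoc, hR, hR, hself]
      have h3 : a * (a * x) = i * (a * x) := by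
        nth_rewrite 1 [hr]
        rw [add_mul, mul_assoc, h2, mul_zero, add_zero]
      rw [← mul_assoc, hR] at h3
      rw [h3, hcomm]
      exact hmul i hi _
    · exact hcon.2 (hmax ⟨hId, haI'⟩ hsub h1)
  have hexcl : ∀ x, a * x ∈ I → a + a * x ∉ I := fun x h h' => haI <| by
    have := hadd _ h' _ h
    rwa [add_assoc, hself, add_zero] at this
  let f : R → ZMod 2 := fun x => if a * x ∈ I then 0 else 1
  have hf0 : ∀ x, a * x ∈ I → f x = 0 := fun x h => if_pos h
  have hf1 : ∀ x, a + a * x ∈ I → f x = 1 := fun x h => if_neg fun h' => hexcl x h' h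
  let φ : R →ₙ+* ZMod 2 :=
    { toFun := f
      map_zero' := hf0 0 (by rwa [mul_zero])
      map_mul' := fun x y => by
        rcases key x with hx | hx
        · rw [hf0 x hx, zero_mul]
          refine hf0 _ ?_
          rw [hcomm x y, ← mul_assoc, hcomm a y, mul_assoc]
          exact hmul _ hx y
        rcases key y with hy | hy
        · rw [hf0 y hy, mul_zero]
          refine hf0 _ ?_
          rw [← mul_assoc, hcomm a x, mul_assoc]
          exact hmul _ hy x
        · rw [hf1 x hx, hf1 y hy, mul_one]
          refine hf1 _ ?_
          have h1 := hadd _ (hmul _ hx y) _ hy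
          have h2 : y * (a + a * x) + (a + a * y) = a + a * (x * y) := by
            rw [mul_add, hcomm y (a * x), hcomm y a, mul_assoc]
            calc a * y + a * (x * y) + (a + a * y) = a + a * (x * y) + (a * y + a * y) := by abel
              _ = _ := by rw [hself, add_zero]
          rwa [h2] at h1
      map_add' := fun x y => by
        rcases key x with hx | hx <;> rcases key y with hy | hy
        · rw [hf0 x hx, hf0 y hy, add_zero]
          exact hf0 _ (by rw [mul_add]; exact hadd _ hx _ hy)
        · rw [hf0 x hx, hf1 y hy, zero_add]
          refine hf1 _ ?_
          have h1 := hadd _ hx _ hy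
          have h2 : a * x + (a + a * y) = a + a * (x + y) := by rw [mul_add]; abel
          rwa [h2] at h1
        · rw [hf1 x hx, hf0 y hy, add_zero]
          refine hf1 _ ?_
          have h1 := hadd _ hx _ hy
          have h2 : a + a * x + a * y = a + a * (x + y) := by rw [mul_add]; abel
          rwa [h2] at h1
        · rw [hf1 x hx, hf1 y hy]
          refine (hf0 _ ?_).trans (by decide)
          have h1 := hadd _ hx _ hy
          have h2 : a + a * x + (a + a * y) = a * (x + y) := by
            calc a + a * x + (a + a * y) = (a + a) + (a * x + a * y) := by abel
              _ = _ := by rw [hself, zero_add, mul_add]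
          rwa [h2] at h1 }
  have hφa : φ a = 1 := hf1 a (by rwa [hR, hself])
  refine ⟨⟨φ, fun h => by simp [h] at hφa⟩, hφa, fun b hb => apply_eq_zero_iff.1 ?_⟩
  exact hf0 b (hmul b (hJI hb) a)

theorem basicOpen_injective (hR : ∀ a : R, a * a = a) :
    Function.Injective (basicOpen : R → Set (StoneSpace R)) := by
  intro a b hab
  have hcomm := mul_comm_of_idempotent hR
  have hself := add_self_eq_zero hR
  have h0 : ∀ c : R, basicOpen c = ∅ → c = 0 := by
    intro c hc
    by_contra hne
    obtain ⟨φ, hφ, -⟩ := exists_mem_basicOpen_forall_notMem hR ⊥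
      (show c ∉ (⊥ : TwoSidedIdeal R) by simpa using hne)
    simp [hc] at hφ
  have h1 : a + a * b = 0 := h0 _ (by rw [basicOpen_add_mul, hab, Set.sdiff_self])
  have h2 : b + b * a = 0 := h0 _ (by rw [basicOpen_add_mul, hab, Set.sdiff_self])
  have h3 : a + b = 0 := by
    have : a + b + (a * b + a * b) = 0 := by
      calc a + b + (a * b + a * b) = (a + a * b) + (b + b * a) := by rw [hcomm b a]; abel
        _ = 0 := by rw [h1, h2, add_zero]
    rwa [hself, add_zero] at this
  calc a = a + (b + b) := by rw [hself, add_zero]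
    _ = b := by rw [← add_assoc, h3, zero_add]

theorem mem_iff_disjoint_closedSet (hR : ∀ a : R, a * a = a) (J : TwoSidedIdeal R) (a : R) :
    a ∈ J ↔ Disjoint (basicOpen a) (closedSet J) := by
  constructor
  · intro ha
    exact Set.disjoint_compl_right_iff_subset.2 (Set.subset_biUnion_of_mem (u := basicOpen) ha)
  · intro h
    by_contra ha
    obtain ⟨φ, hφa, hφ⟩ := exists_mem_basicOpen_forall_notMem hR J ha
    refine Set.disjoint_left.1 h hφa ?_
    simpa [closedSet] using hφ

theorem isClosed_closedSet (J : TwoSidedIdeal R) : IsClosed (closedSet J) :=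
  (isOpen_biUnion fun a _ => isOpen_basicOpen a).isClosed_compl

end BooleanRing

end StoneSpace

/-! ### Subalgebras of the power set -/

section Subalgebra

variable {X : Type u} {op : Set X → Set X} {A : Set (Set X)} {D : BooleanSubalgebra (Set X)}

theorem subset_generatedSubalgebra : A ⊆ generatedSubalgebra op A := fun _ hS =>
  BooleanSubalgebra.mem_sInf.2 fun _ hD => hD.1 hS

theorem op_mem_generatedSubalgebra {S : Set X} (hS : S ∈ generatedSubalgebra op A) :
    op S ∈ generatedSubalgebra op A :=
  BooleanSubalgebra.mem_sInf.2 fun D hD => hD.2 S (BooleanSubalgebra.mem_sInf.1 hS D hD)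

theorem generatedSubalgebra_le (hA : A ⊆ D) (hop : ∀ S ∈ D, op S ∈ D) :
    generatedSubalgebra op A ≤ D :=
  sInf_le ⟨hA, hop⟩

theorem mem_atomSet_iff {S : Set X} :
    S ∈ atomSet D ↔ S ∈ D ∧ S.Nonempty ∧ ∀ T ∈ D, S ⊆ T ∨ Disjoint S T := by
  constructor
  · rintro ⟨hS, hatom⟩
    refine ⟨hS, Set.nonempty_iff_ne_empty.2 fun h => hatom.1 (Subtype.ext h), fun T hT => ?_⟩
    rcases hatom.le_iff.1 (show (⟨S ∩ T, D.inf_mem hS hT⟩ : D) ≤ ⟨S, hS⟩ from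
      Set.inter_subset_left) with h | h
    · exact Or.inr (Set.disjoint_iff_inter_eq_empty.2 (congrArg Subtype.val h))
    · exact Or.inl (Set.inter_eq_left.1 (congrArg Subtype.val h))
  · rintro ⟨hS, hne, h⟩
    refine ⟨hS, fun h0 => hne.ne_empty (congrArg Subtype.val h0), ?_⟩
    rintro ⟨T, hT⟩ hlt
    have hTS : T ⊂ S := hlt
    rcases h T hT with h | h
    · exact absurd h hTS.2
    · exact Subtype.ext (disjoint_self.1 (h.mono_left hTS.1) : T = ⊥)

theorem isPartition_atomSet (hD : (D : Set (Set X)).Finite) : Setoid.IsPartition (atomSet D) := by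
  refine ⟨fun h => by simpa using (mem_atomSet_iff.1 h).2.1, fun x => ?_⟩
  have hmem : ⋂₀ {S | S ∈ D ∧ x ∈ S} ∈ D := by
    have : ∀ 𝒮 : Set (Set X), 𝒮.Finite → 𝒮 ⊆ D → ⋂₀ 𝒮 ∈ D := by
      intro 𝒮 h𝒮
      induction 𝒮, h𝒮 using Set.Finite.induction_on with
      | empty => exact fun _ => by rw [Set.sInter_empty]; exact D.top_mem
      | @insert S 𝒮 _ _ ih =>
        intro h
        rw [Set.sInter_insert]
        exact D.inf_mem (h (Set.mem_insert _ _)) (ih ((Set.subset_insert _ _).trans h))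
    exact this _ (hD.subset fun S hS => hS.1) fun S hS => hS.1
  refine ⟨⋂₀ {S | S ∈ D ∧ x ∈ S}, ⟨mem_atomSet_iff.2 ⟨hmem, ⟨x, fun S hS => hS.2⟩, ?_⟩,
    fun S hS => hS.2⟩, ?_⟩
  · intro T hT
    by_cases hx : x ∈ T
    · exact Or.inl (Set.sInter_subset_of_mem ⟨hT, hx⟩)
    · refine Or.inr (Set.disjoint_left.2 fun y hy hyT => ?_)
      exact hy Tᶜ ⟨D.compl_mem hT, hx⟩ hyT
  · rintro S ⟨hS, hxS⟩
    obtain ⟨hSD, -, hS⟩ := mem_atomSet_iff.1 hS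
    refine (Set.Subset.antisymm ?_ (Set.sInter_subset_of_mem ⟨hSD, hxS⟩))
    refine (hS _ hmem).resolve_right fun h => Set.disjoint_left.1 h hxS fun T hT => hT.2

theorem eq_of_mem_atomSet {S T : Set X} {x : X} (hS : S ∈ atomSet D) (hT : T ∈ atomSet D)
    (hxS : x ∈ S) (hxT : x ∈ T) : S = T := by
  rw [mem_atomSet_iff] at hS hT
  exact ((hS.2.2 T hT.1).resolve_right fun h => Set.disjoint_left.1 h hxS hxT).antisymm
    ((hT.2.2 S hS.1).resolve_right fun h => Set.disjoint_left.1 h hxT hxS)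

/-- The subalgebra of the sets that do not cut any member of `𝒳`. -/
def saturatedSubalgebra (𝒳 : Set (Set X)) : BooleanSubalgebra (Set X) where
  carrier := {S | ∀ A ∈ 𝒳, A ⊆ S ∨ Disjoint A S}
  supClosed' := fun S hS T hT A hA => by
    rcases hS A hA with h | h
    · exact Or.inl (h.trans Set.subset_union_left)
    rcases hT A hA with h' | h'
    · exact Or.inl (h'.trans Set.subset_union_right)
    · exact Or.inr (h.sup_right h')
  infClosed' := fun S hS T hT A hA => by
    rcases hS A hA with h | h
    · rcases hT A hA with h' | h'
      · exact Or.inl (Set.subset_inter h h')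
      · exact Or.inr (h'.mono_right Set.inter_subset_right)
    · exact Or.inr (h.mono_right Set.inter_subset_left)
  compl_mem' := fun {S} hS A hA => by
    rcases hS A hA with h | h
    · exact Or.inr (Set.disjoint_compl_right_iff_subset.2 h)
    · exact Or.inl (Set.subset_compl_iff_disjoint_right.2 h)
  bot_mem' := fun A _ => Or.inr disjoint_bot_right

variable {𝒳 : Set (Set X)}

theorem mem_saturatedSubalgebra {S : Set X} :
    S ∈ saturatedSubalgebra 𝒳 ↔ ∀ A ∈ 𝒳, A ⊆ S ∨ Disjoint A S := Iff.rfl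

theorem sUnion_mem_saturatedSubalgebra {𝒬 : Set (Set X)} (h : ∀ S ∈ 𝒬, S ∈ saturatedSubalgebra 𝒳) :
    ⋃₀ 𝒬 ∈ saturatedSubalgebra 𝒳 := by
  intro A hA
  by_cases hex : ∃ S ∈ 𝒬, A ⊆ S
  · obtain ⟨S, hS, hAS⟩ := hex
    exact Or.inl (hAS.trans (Set.subset_sUnion_of_mem hS))
  · push Not at hex
    exact Or.inr (Set.disjoint_sUnion_right.2 fun S hS =>
      (mem_saturatedSubalgebra.1 (h S hS) A hA).resolve_left (hex S hS))

theorem mem_saturatedSubalgebra_of_isPartition (h : Setoid.IsPartition 𝒳) {S : Set X}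
    (hS : S ∈ 𝒳) : S ∈ saturatedSubalgebra 𝒳 := by
  intro A hA
  by_cases hAS : A = S
  · exact Or.inl hAS.subset
  · exact Or.inr (h.pairwiseDisjoint hA hS hAS)

theorem Setoid.IsPartition.mem_saturatedSubalgebra_of_eq_sUnion (h : Setoid.IsPartition 𝒳)
    {S : Set X} {𝒬 : Set (Set X)} (h𝒬 : 𝒬 ⊆ 𝒳) (hS : S = ⋃₀ 𝒬) : S ∈ saturatedSubalgebra 𝒳 :=
  hS ▸ sUnion_mem_saturatedSubalgebra fun _ hT => mem_saturatedSubalgebra_of_isPartition h (h𝒬 hT)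

theorem eq_sUnion_of_mem_saturatedSubalgebra (h𝒳 : ⋃₀ 𝒳 = Set.univ) {S : Set X}
    (hS : S ∈ saturatedSubalgebra 𝒳) : S = ⋃₀ {A ∈ 𝒳 | A ⊆ S} := by
  refine Set.Subset.antisymm (fun x hx => ?_) (Set.sUnion_subset fun A hA => hA.2)
  obtain ⟨A, hA, hxA⟩ := h𝒳.symm.subset (Set.mem_univ x)
  exact ⟨A, ⟨hA, (hS A hA).resolve_right fun h => Set.disjoint_left.1 h hxA hx⟩, hxA⟩

theorem finite_saturatedSubalgebra (hfin : 𝒳.Finite) (h𝒳 : ⋃₀ 𝒳 = Set.univ) :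
    (saturatedSubalgebra 𝒳 : Set (Set X)).Finite := by
  refine (hfin.finite_subsets.image Set.sUnion).subset fun S hS => ?_
  exact ⟨_, Set.sep_subset _ _, (eq_sUnion_of_mem_saturatedSubalgebra h𝒳 hS).symm⟩

theorem le_saturatedSubalgebra_atomSet : D ≤ saturatedSubalgebra (atomSet D) :=
  fun S hS _ hA => (mem_atomSet_iff.1 hA).2.2 S hS

end Subalgebra

/-! ### Finite-crowded partitions and complete partitions -/

section Partition

variable {X : Type u} [TopologicalSpace X] {A 𝒳 : Set (Set X)}

theorem derivedSet_empty : derivedSet (∅ : Set X) = ∅ := by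
  ext x; simp [derivedSet, AccPt]

theorem derivedSet_sUnion {𝒬 : Set (Set X)} (h : 𝒬.Finite) :
    derivedSet (⋃₀ 𝒬) = ⋃₀ (derivedSet '' 𝒬) := by
  induction 𝒬, h using Set.Finite.induction_on with
  | empty => simp [derivedSet_empty]
  | insert _ _ ih => rw [Set.sUnion_insert, derivedSet_union, ih, Set.image_insert_eq,
      Set.sUnion_insert]

theorem derivedSet_eq_empty_of_finite [T1Space X] {S : Set X} (h : S.Finite) :
    derivedSet S = ∅ := by
  refine Set.eq_empty_of_forall_notMem fun x hx => ?_
  have hx' : AccPt x (Filter.principal S) := hx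
  rw [accPt_iff_frequently] at hx'
  have hU : (S \ {x})ᶜ ∈ nhds x := (h.sdiff.isClosed.isOpen_compl).mem_nhds (by simp)
  obtain ⟨y, hy, hyU⟩ := (hx'.and_eventually hU).exists
  exact hyU ⟨hy.2, hy.1⟩

/-- If the members of the derived algebra are unions of finitely many finite or crowded sets, then
its atoms are finite or crowded: an atom contains no isolated point of itself, or else consists of
isolated points and hence meets no crowded piece. -/
theorem isFiniteCrowdedPartition_atomSet (hfin : 𝒳.Finite) (h𝒳 : ⋃₀ 𝒳 = Set.univ)
    (hfc : ∀ S ∈ 𝒳, S.Finite ∨ IsCrowded S)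
    (hle : derivedSubalgebra A ≤ saturatedSubalgebra 𝒳) :
    (derivedSubalgebra A : Set (Set X)).Finite ∧
      IsFiniteCrowdedPartition (atomSet (derivedSubalgebra A)) := by
  have hD : (derivedSubalgebra A : Set (Set X)).Finite :=
    (finite_saturatedSubalgebra hfin h𝒳).subset hle
  refine ⟨hD, isPartition_atomSet hD, hD.subset fun S hS => (mem_atomSet_iff.1 hS).1,
    fun S hS => ?_⟩
  obtain ⟨hSD, -, hS⟩ := mem_atomSet_iff.1 hS
  rcases hS _ (op_mem_generatedSubalgebra hSD : derivedSet S ∈ _) with h | h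
  · exact Or.inr h
  · left
    rw [eq_sUnion_of_mem_saturatedSubalgebra h𝒳 (hle hSD)]
    refine (hfin.subset (Set.sep_subset _ _)).sUnion ?_
    rintro B ⟨hB, hBS⟩
    rcases hfc B hB with hB' | hB'
    · exact hB'
    · have : B = ∅ := Set.eq_empty_of_forall_notMem fun x hx =>
        Set.disjoint_left.1 h (hBS hx) (derivedSet_mono _ _ hBS (hB' hx))
      rw [this]
      exact Set.finite_empty

theorem derivedSet_inter_derivedSet [T1Space X] {S : Set X} (h : (isolatedPoints S).Finite) :
    derivedSet (S ∩ derivedSet S) = derivedSet S := by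
  conv_rhs => rw [← Set.inter_union_sdiff S (derivedSet S), derivedSet_union]
  have h0 : derivedSet (S \ derivedSet S) = ∅ := derivedSet_eq_empty_of_finite h
  rw [h0, Set.union_empty]

theorem closure_sdiff_isolatedPoints [T1Space X] {S : Set X} :
    closure S \ isolatedPoints S = derivedSet S := by
  rw [closure_eq_self_union_derivedSet]
  ext x
  simp only [isolatedPoints, Set.mem_sdiff, Set.mem_union]
  tauto

/-- Splitting each atom of a finite closure algebra into its isolated points and its limit points
gives a finite-crowded partition, whose unions form an algebra closed under derived sets. -/
theorem finite_derivedSubalgebra_of_closureSubalgebra [T1Space X]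
    (hfin : (closureSubalgebra A : Set (Set X)).Finite)
    (hiso : ∀ S ∈ atomSet (closureSubalgebra A), (isolatedPoints S).Finite) :
    (derivedSubalgebra A : Set (Set X)).Finite ∧
      IsFiniteCrowdedPartition (atomSet (derivedSubalgebra A)) := by
  set E := closureSubalgebra A with hE
  have hpart := isPartition_atomSet hfin
  have hatoms : (atomSet E).Finite := hfin.subset fun S hS => (mem_atomSet_iff.1 hS).1
  let 𝒳 : Set (Set X) := (fun S => S ∩ derivedSet S) '' atomSet E ∪ isolatedPoints '' atomSet E
  have h𝒳fin : 𝒳.Finite := (hatoms.image _).union (hatoms.image _)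
  have h𝒳 : ⋃₀ 𝒳 = Set.univ := by
    refine Set.eq_univ_of_forall fun x => ?_
    obtain ⟨S, hS, hx⟩ := hpart.sUnion_eq_univ.symm.subset (Set.mem_univ x)
    by_cases hx' : x ∈ derivedSet S
    · exact ⟨_, Or.inl ⟨S, hS, rfl⟩, hx, hx'⟩
    · exact ⟨_, Or.inr ⟨S, hS, rfl⟩, hx, hx'⟩
  have hsub : ∀ B ∈ 𝒳, ∃ S ∈ atomSet E, B ⊆ S := by
    rintro _ (⟨S, hS, rfl⟩ | ⟨S, hS, rfl⟩)
    · exact ⟨S, hS, Set.inter_subset_left⟩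
    · exact ⟨S, hS, Set.sdiff_subset⟩
  have hEsat : E ≤ saturatedSubalgebra 𝒳 := fun T hT B hB => by
    obtain ⟨S, hS, hBS⟩ := hsub B hB
    exact ((mem_atomSet_iff.1 hS).2.2 T hT).imp hBS.trans fun h => h.mono_left hBS
  have hisosat : ∀ S ∈ atomSet E, isolatedPoints S ∈ saturatedSubalgebra 𝒳 := by
    rintro S hS _ (⟨T, hT, rfl⟩ | ⟨T, hT, rfl⟩)
    · refine Or.inr (Set.disjoint_left.2 fun x hx hx' => ?_)
      obtain rfl := eq_of_mem_atomSet hS hT hx'.1 hx.1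
      exact hx'.2 hx.2
    · by_cases hST : T = S
      · exact Or.inl (by rw [hST])
      · refine Or.inr (Set.disjoint_left.2 fun x hx hx' => hST ?_)
        exact eq_of_mem_atomSet hT hS hx.1 hx'.1
  have hder : ∀ S ∈ atomSet E, derivedSet S ∈ saturatedSubalgebra 𝒳 := fun S hS => by
    rw [← closure_sdiff_isolatedPoints]
    exact (saturatedSubalgebra 𝒳).sdiff_mem
      (hEsat (op_mem_generatedSubalgebra (mem_atomSet_iff.1 hS).1)) (hisosat S hS)
  refine isFiniteCrowdedPartition_atomSet h𝒳fin h𝒳 ?_ (generatedSubalgebra_le ?_ ?_)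
  · rintro _ (⟨S, hS, rfl⟩ | ⟨S, hS, rfl⟩)
    · right
      change S ∩ derivedSet S ⊆ derivedSet (S ∩ derivedSet S)
      rw [derivedSet_inter_derivedSet (hiso S hS)]
      exact Set.inter_subset_right
    · exact Or.inl (hiso S hS)
  · exact fun S hS => hEsat (subset_generatedSubalgebra hS)
  · intro S hS
    rw [eq_sUnion_of_mem_saturatedSubalgebra h𝒳 hS,
      derivedSet_sUnion (h𝒳fin.subset (Set.sep_subset _ _))]
    refine sUnion_mem_saturatedSubalgebra ?_
    rintro _ ⟨_, ⟨⟨T, hT, rfl⟩ | ⟨T, hT, rfl⟩, -⟩, rfl⟩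
    · simp only
      rw [derivedSet_inter_derivedSet (hiso T hT)]
      exact hder T hT
    · rw [derivedSet_eq_empty_of_finite (hiso T hT)]
      exact (saturatedSubalgebra 𝒳).bot_mem

/-- The algebra generated by closed sets under derived sets is generated, as a Boolean algebra, by
its closed members: the sets that do not separate points with the same closed members of the
algebra around them form a subalgebra closed under derived sets. -/
theorem mem_of_forall_isClosed_mem_iff [T1Space X] (hA : ∀ S ∈ A, IsClosed S) {S : Set X}
    (hS : S ∈ derivedSubalgebra A) {x y : X}
    (hxy : ∀ F ∈ derivedSubalgebra A, IsClosed F → (x ∈ F ↔ y ∈ F)) (hx : x ∈ S) : y ∈ S := by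
  have key : ∀ F ∈ derivedSubalgebra A, IsClosed F →
      F ∈ derivedSubalgebra A ⊓ saturatedSubalgebra
        {P : Set X | ∀ F ∈ derivedSubalgebra A, IsClosed F → P ⊆ F ∨ Disjoint P F} :=
    fun F hF hFc => ⟨hF, fun P hP => hP F hF hFc⟩
  have hle : derivedSubalgebra A ≤ derivedSubalgebra A ⊓ saturatedSubalgebra
        {P : Set X | ∀ F ∈ derivedSubalgebra A, IsClosed F → P ⊆ F ∨ Disjoint P F} :=
    generatedSubalgebra_le
      (fun F hF => key F (subset_generatedSubalgebra hF) (hA F hF))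
      (fun F hF => key _ (op_mem_generatedSubalgebra hF.1) (isClosed_derivedSet F))
  rcases (hle hS).2 {x, y} (fun F hF hFc => by
    by_cases h : x ∈ F
    · exact Or.inl (Set.pair_subset h ((hxy F hF hFc).1 h))
    · refine Or.inr (Set.disjoint_left.2 ?_)
      rintro z (rfl | rfl)
      · exact h
      · exact fun hz => h ((hxy F hF hFc).2 hz)) with h | h
  · exact h (by simp)
  · exact absurd hx (Set.disjoint_left.1 h (by simp))

theorem exists_isCompletePartition_atomSet [T1Space X] (hA : ∀ S ∈ A, IsClosed S)
    (hfin : (derivedSubalgebra A : Set (Set X)).Finite) :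
    ∃ (P : Type) (_ : Finite P) (po : POSystem P),
      IsCompletePartition po (atomSet (derivedSubalgebra A)) := by
  set D := derivedSubalgebra A with hD
  have hpart := isPartition_atomSet hfin
  have hatoms : Finite (atomSet D) := hfin.subset fun S hS => (mem_atomSet_iff.1 hS).1
  obtain ⟨k, ⟨e⟩⟩ := Finite.exists_equiv_fin (atomSet D)
  let f : Fin k → Set X := fun p => (e.symm p).1
  have hf : ∀ p, f p ∈ atomSet D := fun p => (e.symm p).2
  have hfinj : Function.Injective f := Subtype.val_injective.comp e.symm.injective
  have hrange : Set.range f = atomSet D := by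
    refine Set.Subset.antisymm (Set.range_subset_iff.2 hf) fun S hS => ⟨e ⟨S, hS⟩, ?_⟩
    simp [f]
  -- The closed members of the algebra that contain one of two atoms with equal closures
  -- contain both.
  have hclos : ∀ p q, f q ⊆ derivedSet (f p) → ∀ F ∈ D, IsClosed F →
      ∀ x ∈ f p, ∀ y ∈ f q, x ∈ F → y ∈ F := by
    intro p q hqp F hF hFc x hx y hy hxF
    have h1 : f p ⊆ F := ((mem_atomSet_iff.1 (hf p)).2.2 F hF).resolve_right
      fun h => Set.disjoint_left.1 h hx hxF
    exact hFc.closure_subset_iff.2 h1 (derivedSet_subset_closure _ (hqp hy))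
  refine ⟨Fin k, inferInstance, ⟨fun q p => f q ⊆ derivedSet (f p), ?_, ?_⟩, hpart, f, hfinj,
    hrange, ?_⟩
  · intro p q r hpq hqr
    refine hpq.trans ((derivedSet_mono _ _ hqr).trans ?_)
    exact (isClosed_iff_derivedSet_subset _).1 (isClosed_derivedSet _)
  · intro p q hpq hqp
    obtain ⟨x, hx⟩ := (mem_atomSet_iff.1 (hf p)).2.1
    obtain ⟨y, hy⟩ := (mem_atomSet_iff.1 (hf q)).2.1
    have hyx : y ∈ f p := mem_of_forall_isClosed_mem_iff hA (mem_atomSet_iff.1 (hf p)).1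
      (fun F hF hFc => ⟨hclos p q hqp F hF hFc x hx y hy, hclos q p hpq F hF hFc y hy x hx⟩) hx
    exact hfinj (eq_of_mem_atomSet (hf p) (hf q) hyx hy)
  · intro p
    have hmem : derivedSet (f p) ∈ D := op_mem_generatedSubalgebra (mem_atomSet_iff.1 (hf p)).1
    refine (eq_sUnion_of_mem_saturatedSubalgebra hpart.sUnion_eq_univ
      (le_saturatedSubalgebra_atomSet hmem)).trans ?_
    ext x
    simp only [Set.mem_sUnion, Set.mem_iUnion, ← hrange]
    constructor
    · rintro ⟨_, ⟨⟨q, rfl⟩, hq⟩, hx⟩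
      exact ⟨q, hq, hx⟩
    · rintro ⟨q, hq, hx⟩
      exact ⟨_, ⟨⟨q, rfl⟩, hq⟩, hx⟩

theorem partitionRefines_atomSet {ι : Type} {C : ι → Set X}
    (h : Setoid.IsPartition (atomSet (derivedSubalgebra (Set.range C)))) :
    PartitionRefines (atomSet (derivedSubalgebra (Set.range C))) C := fun i =>
  ⟨_, Set.sep_subset _ _, eq_sUnion_of_mem_saturatedSubalgebra h.sUnion_eq_univ
    (le_saturatedSubalgebra_atomSet (subset_generatedSubalgebra ⟨i, rfl⟩))⟩

end Partition

/-! ### Definable ideals -/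

instance (n : ℕ) : Countable (idealLanguage n).Symbols := by
  have h1 : Countable (Σ l, RngFunc l) := by
    refine Function.Injective.countable (β := ℕ) (f := fun x => match x with
      | ⟨_, RngFunc.zero⟩ => 0
      | ⟨_, RngFunc.neg⟩ => 1
      | ⟨_, RngFunc.add⟩ => 2
      | ⟨_, RngFunc.mul⟩ => 3) ?_
    rintro ⟨_, _ | _⟩ ⟨_, _ | _⟩ h <;> simp_all
  have h2 : Countable (Σ l, IdealRel n l) := by
    refine Function.Injective.countable (β := Fin n) (f := fun x => match x with
      | ⟨_, IdealRel.ideal i⟩ => i) ?_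
    rintro ⟨_, ⟨i⟩⟩ ⟨_, ⟨j⟩⟩ h
    obtain rfl : i = j := h
    rfl
  exact inferInstanceAs (Countable ((Σ l, RngFunc l) ⊕ (Σ l, IdealRel n l)))

section Definable

variable {R : Type u} [NonUnitalRing R] {n : ℕ} {J : Fin n → TwoSidedIdeal R}

/-- A set of elements of `R` is definable without parameters in the structure `(R, J₁, …, Jₙ)`. -/
def IsDefinableIn (J : Fin n → TwoSidedIdeal R) (P : Set R) : Prop :=
  letI := idealStructure J
  (∅ : Set R).Definable (idealLanguage n) {x : Fin 1 → R | x 0 ∈ P}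

theorem IsDefinableIn.compl {P : Set R} (h : IsDefinableIn J P) : IsDefinableIn J Pᶜ :=
  letI := idealStructure J
  Set.Definable.compl h

theorem IsDefinableIn.inter {P Q : Set R} (hP : IsDefinableIn J P) (hQ : IsDefinableIn J Q) :
    IsDefinableIn J (P ∩ Q) :=
  letI := idealStructure J
  Set.Definable.inter hP hQ

theorem isDefinableIn_univ : IsDefinableIn J Set.univ :=
  letI := idealStructure J
  Set.definable_univ

theorem isDefinableIn_ideal (i : Fin n) : IsDefinableIn J {a | a ∈ J i} := by
  let _ := idealStructure J
  refine Set.empty_definable_iff.2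
    ⟨Relations.formula (L := idealLanguage n) (IdealRel.ideal i) ![Term.var 0], ?_⟩
  ext x
  simp only [Set.mem_ofPred_eq]
  rfl

theorem isDefinableIn_zero : IsDefinableIn J {0} := by
  let _ := idealStructure J
  refine Set.empty_definable_iff.2
    ⟨Term.equal (L := idealLanguage n) (Term.var 0) (Term.func RngFunc.zero Fin.elim0), ?_⟩
  ext x
  simp only [Set.mem_ofPred_eq, Formula.realize_equal]
  rfl

theorem IsDefinableIn.exists_split {P Q : Set R} (hP : IsDefinableIn J P)
    (hQ : IsDefinableIn J Q) : IsDefinableIn J {a | ∃ b, a * b ∈ P ∧ a + a * b ∈ Q} := by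
  let _ := idealStructure J
  obtain ⟨φ, hφ⟩ := Set.empty_definable_iff.1 hP
  obtain ⟨ψ, hψ⟩ := Set.empty_definable_iff.1 hQ
  let t : (idealLanguage n).Term (Fin 2) := Term.func RngFunc.mul ![Term.var 0, Term.var 1]
  let s : (idealLanguage n).Term (Fin 2) := Term.func RngFunc.add ![Term.var 0, t]
  have ht : ∀ v : Fin 2 → R, t.realize v = v 0 * v 1 := fun v => rfl
  have hs : ∀ v : Fin 2 → R, s.realize v = v 0 + v 0 * v 1 := fun v => rfl
  have h : (∅ : Set R).Definable (idealLanguage n)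
      {v : Fin 2 → R | v 0 * v 1 ∈ P ∧ v 0 + v 0 * v 1 ∈ Q} := by
    refine Set.empty_definable_iff.2
      ⟨BoundedFormula.subst φ (fun _ => t) ⊓ BoundedFormula.subst ψ (fun _ => s), ?_⟩
    ext v
    have h1 := Set.ext_iff.1 hφ fun _ => v 0 * v 1
    have h2 := Set.ext_iff.1 hψ fun _ => v 0 + v 0 * v 1
    simp only [Set.mem_ofPred_eq] at h1 h2 ⊢
    rw [h1, h2, Formula.realize_inf]
    simp only [Formula.Realize, BoundedFormula.realize_subst, ht, hs]
  refine Eq.mpr (congrArg (Set.Definable _ _) (?_ : {x : Fin 1 → R | x 0 ∈ {a | ∃ b, a * b ∈ P ∧ a + a * b ∈ Q}} =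
      (fun v => v ∘ (![0] : Fin 1 → Fin 2)) '' {v | v 0 * v 1 ∈ P ∧ v 0 + v 0 * v 1 ∈ Q})) (h.image_comp (![0] : Fin 1 → Fin 2))
  ext x
  constructor
  · rintro ⟨b, hb⟩
    exact ⟨![x 0, b], hb, by ext i; fin_cases i; rfl⟩
  · rintro ⟨v, hv, rfl⟩
    exact ⟨v 1, hv⟩

theorem finite_setOf_isDefinableIn [Countable R] (h : IsOmegaCategoricalSystem J) :
    {P : Set R | IsDefinableIn J P}.Finite := by
  let _ := idealStructure J
  have hfin := IsOmegaCategorical.finite_definable (show IsOmegaCategorical (idealLanguage n) R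
    from h) 1
  refine Set.Finite.of_finite_image (f := fun P => {x : Fin 1 → R | x 0 ∈ P}) (hfin.subset ?_) ?_
  · rintro _ ⟨P, hP, rfl⟩
    exact hP
  · intro P _ Q _ hPQ
    ext a
    exact Set.ext_iff.1 hPQ fun _ => a

end Definable

/-! ### Categorical systems have a finite closure algebra -/

namespace StoneSpace

section

variable {R : Type u} [NonUnitalRing R] {n : ℕ} {J : Fin n → TwoSidedIdeal R}

/-- The ideal of those elements of `R` whose basic open sets miss `S`. -/
def vanishing (S : Set (StoneSpace R)) : Set R :=
  {a | Disjoint (basicOpen a) S}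

theorem vanishing_union (S T : Set (StoneSpace R)) :
    vanishing (S ∪ T) = vanishing S ∩ vanishing T :=
  Set.ext fun _ => disjoint_sup_right

theorem vanishing_closure (S : Set (StoneSpace R)) : vanishing (closure S) = vanishing S :=
  Set.ext fun a => ⟨fun h => h.mono_right subset_closure,
    fun h => Disjoint.closure_right h (isOpen_basicOpen a)⟩

theorem vanishing_empty : vanishing (∅ : Set (StoneSpace R)) = Set.univ :=
  Set.eq_univ_of_forall fun _ => disjoint_bot_right

theorem vanishing_univ (hR : ∀ a : R, a * a = a) :
    vanishing (Set.univ : Set (StoneSpace R)) = {0} := by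
  ext a
  have : Disjoint (basicOpen a) Set.univ ↔ basicOpen a = basicOpen 0 := by
    rw [Set.disjoint_univ, basicOpen_zero]
  exact this.trans (basicOpen_injective hR).eq_iff

theorem vanishing_inter {F G : Set (StoneSpace R)} (hF : IsClosed F) (hG : IsClosed G) :
    vanishing (F ∩ G) = {a | ∃ b, a * b ∈ vanishing F ∧ a + a * b ∈ vanishing G} := by
  ext a
  simp only [vanishing, Set.mem_ofPred_eq, basicOpen_mul, basicOpen_add_mul, Set.disjoint_left,
    Set.mem_inter_iff, Set.mem_sdiff]
  constructor
  · intro h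
    obtain ⟨b, hb, hbF⟩ := exists_basicOpen_subset ((isCompact_basicOpen a).inter_right hG)
      hF.isOpen_compl fun x hx hxF => h hx.1 ⟨hxF, hx.2⟩
    exact ⟨b, fun x hx hxF => hbF hx.2 hxF, fun x hx hxG => hx.2 (hb ⟨hx.1, hxG⟩)⟩
  · rintro ⟨b, h1, h2⟩ x hx ⟨hxF, hxG⟩
    by_cases hxb : x ∈ basicOpen b
    · exact h1 ⟨hx, hxb⟩ hxF
    · exact h2 ⟨hx, hxb⟩ hxG

theorem vanishing_sdiff {F G : Set (StoneSpace R)} (hG : IsClosed G) :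
    vanishing (F \ G) =
      {a | ∃ b, a * b ∈ vanishing G ∩ (vanishing F)ᶜ ∧ a + a * b ∈ Set.univ}ᶜ := by
  ext a
  simp only [vanishing, Set.mem_compl_iff, Set.mem_ofPred_eq, Set.mem_inter_iff, Set.mem_univ,
    and_true, not_exists, basicOpen_mul]
  constructor
  · rintro h b ⟨h1, h2⟩
    refine h2 (Set.disjoint_left.2 fun x hx hxF => ?_)
    exact Set.disjoint_left.1 h hx.1 ⟨hxF, Set.disjoint_left.1 h1 hx⟩
  · intro h
    refine Set.disjoint_left.2 fun x hx hxFG => ?_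
    obtain ⟨_, ⟨b, rfl⟩, hxb, hb⟩ := isTopologicalBasis_basicOpen.exists_subset_of_mem_open
      (show x ∈ Gᶜ from hxFG.2) hG.isOpen_compl
    exact h b ⟨Set.disjoint_left.2 fun y hy hyG => hb hy.2 hyG,
      Set.not_disjoint_iff.2 ⟨x, ⟨hx, hxb⟩, hxFG.1⟩⟩

theorem vanishing_injOn : Set.InjOn vanishing {F : Set (StoneSpace R) | IsClosed F} := by
  have key : ∀ F G : Set (StoneSpace R), IsClosed F → vanishing F = vanishing G → G ⊆ F := by
    intro F G hF h x hxG
    by_contra hxF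
    obtain ⟨_, ⟨b, rfl⟩, hxb, hb⟩ := isTopologicalBasis_basicOpen.exists_subset_of_mem_open
      (show x ∈ Fᶜ from hxF) hF.isOpen_compl
    have hbF : b ∈ vanishing F := Set.disjoint_left.2 fun y hy hyF => hb hy hyF
    rw [h] at hbF
    exact Set.disjoint_left.1 hbF hxb hxG
  exact fun F hF G hG h => (key G F hG h.symm).antisymm (key F G hF h)

/-- The closed sets whose ideals are definable form a lattice, which is finite in a categorical
system and contains the closure of the difference of any two of its members. So the Boolean
algebra that it generates is finite and closed under closure. -/
theorem closureSubalgebra_finite_of_isOmegaCategoricalSystem [Countable R]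
    (hR : ∀ a : R, a * a = a) (h : IsOmegaCategoricalSystem J) {C : Fin n → Set (StoneSpace R)}
    (hC : ∀ i, C i = closedSet (J i)) :
    (closureSubalgebra (Set.range C) : Set (Set (StoneSpace R))).Finite ∧
      ∀ S ∈ closureSubalgebra (Set.range C), IsDefinableIn J (vanishing S) := by
  let 𝓕 : Set (Set (StoneSpace R)) := {F | IsClosed F ∧ IsDefinableIn J (vanishing F)}
  have hfin : 𝓕.Finite := by
    refine Set.Finite.of_finite_image (f := vanishing) ((finite_setOf_isDefinableIn h).subset ?_)
      (vanishing_injOn.mono fun F hF => hF.1)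
    rintro _ ⟨F, hF, rfl⟩
    exact hF.2
  have hlat : IsSublattice 𝓕 :=
    { supClosed := fun F hF G hG => ⟨hF.1.union hG.1, by
        have := hF.2.inter hG.2
        rwa [← vanishing_union] at this⟩
      infClosed := fun F hF G hG => ⟨hF.1.inter hG.1, by
        have := hF.2.exists_split hG.2
        rwa [← vanishing_inter hF.1 hG.1] at this⟩ }
  have hbot : ⊥ ∈ 𝓕 := ⟨isClosed_empty, by
    have := isDefinableIn_univ (J := J)
    rwa [← vanishing_empty] at this⟩
  have htop : ⊤ ∈ 𝓕 := ⟨isClosed_univ, by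
    have := isDefinableIn_zero (J := J)
    rwa [← vanishing_univ hR] at this⟩
  have hcl : ∀ F ∈ 𝓕, ∀ G ∈ 𝓕, closure (F \ G) ∈ 𝓕 := fun F hF G hG => ⟨isClosed_closure, by
    have := ((hG.2.inter hF.2.compl).exists_split isDefinableIn_univ).compl
    rwa [← vanishing_sdiff hG.1, ← vanishing_closure] at this⟩
  have hclosure : ∀ S ∈ BooleanSubalgebra.closure 𝓕, closure S ∈ 𝓕 := by
    intro S hS
    induction S, hS using BooleanSubalgebra.closure_sdiff_sup_induction hlat hbot htop with
    | sdiff F hF G hG => exact hcl F hF G hG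
    | sup S _ T _ ihS ihT =>
      have : closure (S ⊔ T) = closure S ⊔ closure T := closure_union
      rw [this]
      exact hlat.supClosed ihS ihT
  have hle : closureSubalgebra (Set.range C) ≤ BooleanSubalgebra.closure 𝓕 := by
    refine generatedSubalgebra_le ?_ fun S hS => BooleanSubalgebra.subset_closure (hclosure S hS)
    rintro _ ⟨i, rfl⟩
    refine BooleanSubalgebra.subset_closure ?_
    rw [hC]
    refine ⟨isClosed_closedSet _, ?_⟩
    have : vanishing (closedSet (J i)) = {a | a ∈ J i} :=
      Set.ext fun a => (mem_iff_disjoint_closedSet hR (J i) a).symm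
    rw [this]
    exact isDefinableIn_ideal i
  have hfin' : (BooleanSubalgebra.closure 𝓕 : Set (Set (StoneSpace R))).Finite := by
    have : Finite 𝓕 := hfin
    refine (Set.finite_range fun t : Finset (𝓕 × 𝓕) => t.sup fun x => x.1.1 \ x.2.1).subset ?_
    intro S hS
    obtain ⟨t, rfl⟩ := (BooleanSubalgebra.mem_closure_iff_sup_sdiff hlat hbot htop).1 hS
    exact ⟨t, rfl⟩
  exact ⟨hfin'.subset hle, fun S hS => vanishing_closure S ▸ (hclosure S (hle hS)).2⟩

theorem encard_basicOpen_inter_split (a b : R) (S : Set (StoneSpace R)) :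
    (basicOpen a ∩ S).encard = (basicOpen (a * b) ∩ S).encard +
      (basicOpen (a + a * b) ∩ S).encard := by
  rw [← Set.encard_union_eq]
  · congr 1
    rw [basicOpen_mul, basicOpen_add_mul]
    ext x
    simp only [Set.mem_inter_iff, Set.mem_union, Set.mem_sdiff]
    tauto
  · rw [basicOpen_mul, basicOpen_add_mul]
    exact Set.disjoint_left.2 fun x hx hx' => hx'.1.2 hx.1.2

/-- That `basicOpen a` has at most `k` points in `S` is expressible by a formula: at most `k + 1`
points means that removing a part which meets `S` leaves at most `k`. -/
theorem isDefinableIn_encard_le {S : Set (StoneSpace R)} (hS : IsDefinableIn J (vanishing S))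
    (k : ℕ) : IsDefinableIn J {a | (basicOpen a ∩ S).encard ≤ k} := by
  induction k with
  | zero =>
    convert hS using 1
    ext a
    simp [vanishing, Set.disjoint_iff_inter_eq_empty]
  | succ k ih =>
    convert (hS.compl.exists_split ih.compl).compl using 1
    ext a
    simp only [Set.mem_ofPred_eq, Set.mem_compl_iff, not_exists, not_and, not_le]
    constructor
    · intro h b hb
      by_contra! hlt
      rw [encard_basicOpen_inter_split a b] at h
      have h1 : 1 ≤ (basicOpen (a * b) ∩ S).encard :=
        Set.one_le_encard_iff_nonempty.2 (Set.not_disjoint_iff_nonempty_inter.1 hb)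
      have h2 : (k : ℕ∞) + 1 ≤ (basicOpen (a + a * b) ∩ S).encard :=
        Order.add_one_le_of_lt hlt
      have h3 := (add_le_add h1 h2).trans h
      norm_cast at h3
      omega
    · intro h
      by_contra! hlt
      have hlt' : ((k + 2 : ℕ) : ℕ∞) ≤ (basicOpen a ∩ S).encard := by
        have := Order.add_one_le_of_lt hlt
        exact_mod_cast this
      obtain ⟨T, hTS, hT⟩ := Set.exists_subset_encard_eq hlt'
      have hTfin : T.Finite := Set.finite_of_encard_eq_coe hT
      obtain ⟨x, hx⟩ : T.Nonempty := by
        rw [← Set.encard_pos, hT]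
        exact_mod_cast Nat.succ_pos _
      obtain ⟨_, ⟨b, rfl⟩, hxb, hb⟩ := isTopologicalBasis_basicOpen.exists_subset_of_mem_open
        (show x ∈ (T \ {x})ᶜ by simp) (hTfin.sdiff (t := {x})).isClosed.isOpen_compl
      have hsub : T \ {x} ⊆ basicOpen (a + a * b) ∩ S := fun y hy => by
        rw [basicOpen_add_mul]
        exact ⟨⟨(hTS hy.1).1, fun hyb => hb hyb hy⟩, (hTS hy.1).2⟩
      have hle := (Set.encard_le_encard hsub).trans (not_lt.1 <| h b fun hd => by
        refine Set.disjoint_left.1 hd ?_ (hTS hx).2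
        rw [basicOpen_mul]
        exact ⟨(hTS hx).1, hxb⟩)
      have hcard := Set.encard_sdiff_singleton_add_one hx
      rw [hT] at hcard
      have := add_le_add_left hle 1
      rw [hcard] at this
      norm_cast at this
      omega

theorem exists_basicOpen_inter_eq {S T : Set (StoneSpace R)} (hT : T ⊆ isolatedPoints S)
    (hfin : T.Finite) : ∃ a : R, basicOpen a ∩ S = T := by
  obtain ⟨a, hTa, ha⟩ := exists_basicOpen_subset hfin.isCompact
    (isClosed_closure (s := S \ T)).isOpen_compl fun x hx hx' => by
      rw [closure_eq_self_union_derivedSet] at hx'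
      rcases hx' with h | h
      · exact h.2 hx
      · exact (hT hx).2 (derivedSet_mono _ _ Set.sdiff_subset h)
  refine ⟨a, Set.Subset.antisymm (fun x hx => ?_) fun x hx => ⟨hTa hx, (hT hx).1⟩⟩
  by_contra hxT
  exact ha hx.1 (subset_closure ⟨hx.2, hxT⟩)

/-- If `S` had infinitely many isolated points, then having at most `k` points in `S` would be a
different condition for each `k`. -/
theorem finite_isolatedPoints_of_isOmegaCategoricalSystem [Countable R]
    (h : IsOmegaCategoricalSystem J) {S : Set (StoneSpace R)}
    (hS : IsDefinableIn J (vanishing S)) : (isolatedPoints S).Finite := by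
  by_contra hinf
  have hinj : Function.Injective fun k : ℕ => {a : R | (basicOpen a ∩ S).encard ≤ k} := by
    refine Function.Injective.of_lt_imp_ne fun j k hjk heq => ?_
    obtain ⟨T, hT, hTk⟩ := Set.Infinite.exists_subset_card_eq hinf k
    obtain ⟨a, ha⟩ := exists_basicOpen_inter_eq hT T.finite_toSet
    have hcard : (basicOpen a ∩ S).encard = k := by
      rw [ha, Set.encard_coe_eq_coe_finsetCard, hTk]
    have h1 : a ∈ {a : R | (basicOpen a ∩ S).encard ≤ j} := by
      rw [heq]
      exact hcard.le
    have h2 : (basicOpen a ∩ S).encard ≤ j := h1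
    rw [hcard] at h2
    norm_cast at h2
    omega
  exact (Set.infinite_range_of_injective hinj) ((finite_setOf_isDefinableIn h).subset
    (Set.range_subset_iff.2 fun k => isDefinableIn_encard_le hS k))

end

end StoneSpace

/-! ### Complete partitions and back-and-forth -/

theorem IsCrowded.encard_inter {X : Type u} [TopologicalSpace X] [T1Space X] {S O : Set X}
    (hS : IsCrowded S) (hO : IsOpen O) (hne : (O ∩ S).Nonempty) : (O ∩ S).encard = ⊤ := by
  rw [Set.encard_eq_top_iff]
  intro hfin
  obtain ⟨x, hxO, hxS⟩ := hne
  have hx : AccPt x (Filter.principal S) := hS hxS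
  rw [accPt_iff_frequently] at hx
  have hU : O \ ((O ∩ S) \ {x}) ∈ nhds x :=
    (hO.sdiff hfin.sdiff.isClosed).mem_nhds ⟨hxO, by simp⟩
  obtain ⟨y, hy, hyU⟩ := (hx.and_eventually hU).exists
  exact hyU.2 ⟨⟨hyU.1, hy.2⟩, hy.1⟩

/-- A finite family `f` of sets that partitions `X` into finite or crowded sets and that is
complete: the derived set of each member is a union of members. -/
structure IsFiniteCrowdedFamily {X : Type u} [TopologicalSpace X] {P : Type} (lt : P → P → Prop)
    (f : P → Set X) : Prop where
  eq_of_mem : ∀ {p q x}, x ∈ f p → x ∈ f q → p = q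
  exists_mem : ∀ x, ∃ p, x ∈ f p
  derivedSet_eq : ∀ p, derivedSet (f p) = ⋃ (q : P) (_ : lt q p), f q
  finite_or_crowded : ∀ p, (f p).Finite ∨ IsCrowded (f p)

namespace IsFiniteCrowdedFamily

section

variable {X : Type u} [TopologicalSpace X] {P : Type} {lt : P → P → Prop}
  {f : P → Set X}

/-- The types `p` that occur in an open set are closed upwards, so the points of all other types
form a closed set. -/
theorem isClosed_iUnion [Finite P] (hf : IsFiniteCrowdedFamily lt f) {U : Set X} (hU : IsOpen U) :
    IsClosed (⋃ p ∈ {p | ¬ (U ∩ f p).Nonempty}, f p) := by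
  rw [isClosed_iff_derivedSet_subset, ← Set.sUnion_image,
    derivedSet_sUnion ((Set.toFinite _).image f)]
  rintro x ⟨_, ⟨_, ⟨p, hp, rfl⟩, rfl⟩, hx⟩
  have hx' := hx
  rw [hf.derivedSet_eq] at hx
  simp only [Set.mem_iUnion] at hx
  obtain ⟨q, hqp, hxq⟩ := hx
  refine ⟨_, ⟨q, fun hq => hp ?_, rfl⟩, hxq⟩
  obtain ⟨y, hyU, hyq⟩ := hq
  have hy : y ∈ derivedSet (f p) := by
    rw [hf.derivedSet_eq]
    exact Set.mem_iUnion₂.2 ⟨q, hqp, hyq⟩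
  exact mem_closure_iff.1 (derivedSet_subset_closure _ hy) U hU hyU

/-- Representative points: finite disjoint sets of points of type `p` in `V` that imitate the
points of type `p` in the two pieces of `U`. -/
theorem exists_representatives [T1Space X] (hf : IsFiniteCrowdedFamily lt f) {U₁ U₂ V : Set X}
    (hV : IsOpen V) (hdisj : Disjoint U₁ U₂) (p : P)
    (hUV : ((U₁ ∪ U₂) ∩ f p).encard = (V ∩ f p).encard) :
    ∃ G₁ G₂ : Set X, G₁.Finite ∧ G₂.Finite ∧ G₁ ⊆ V ∩ f p ∧ G₂ ⊆ V ∩ f p ∧ Disjoint G₁ G₂ ∧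
      (G₁.Nonempty ↔ (U₁ ∩ f p).Nonempty) ∧ (G₂.Nonempty ↔ (U₂ ∩ f p).Nonempty) ∧
      ((f p).Finite → G₁ ∪ G₂ = V ∩ f p ∧ G₁.encard = (U₁ ∩ f p).encard ∧
        G₂.encard = (U₂ ∩ f p).encard) := by
  classical
  have hsplit : (V ∩ f p).encard = (U₁ ∩ f p).encard + (U₂ ∩ f p).encard := by
    rw [← hUV, Set.union_inter_distrib_right, Set.encard_union_eq]
    exact hdisj.mono Set.inter_subset_left Set.inter_subset_left
  by_cases hfin : (f p).Finite
  · obtain ⟨G, hG, hGcard⟩ := Set.exists_subset_encard_eq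
      (show (U₁ ∩ f p).encard ≤ (V ∩ f p).encard by rw [hsplit]; exact le_self_add)
    have hVfin : (V ∩ f p).Finite := hfin.subset Set.inter_subset_right
    have hGfin : G.Finite := hVfin.subset hG
    have hG' : ((V ∩ f p) \ G).encard = (U₂ ∩ f p).encard := by
      have h1 := Set.encard_sdiff_add_encard_of_subset hG
      rw [hsplit, hGcard, add_comm (U₁ ∩ f p).encard] at h1
      exact ENat.add_left_injective_of_ne_top (Set.encard_ne_top_iff.2
        (hfin.subset Set.inter_subset_right)) h1
    refine ⟨G, (V ∩ f p) \ G, hGfin, hVfin.sdiff, hG, Set.sdiff_subset, Set.disjoint_sdiff_right,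
      ?_, ?_, fun _ => ⟨Set.union_sdiff_cancel hG, hGcard, hG'⟩⟩
    · rw [← Set.encard_pos, hGcard, Set.encard_pos]
    · rw [← Set.encard_pos, hG', Set.encard_pos]
  · have hcr := (hf.finite_or_crowded p).resolve_left hfin
    by_cases hne : (V ∩ f p).Nonempty
    · have hinf : (V ∩ f p).Infinite := Set.encard_eq_top_iff.1 (hcr.encard_inter hV hne)
      obtain ⟨x, hx, y, hy, hxy⟩ := hinf.nontrivial
      refine ⟨{z | z = x ∧ (U₁ ∩ f p).Nonempty}, {z | z = y ∧ (U₂ ∩ f p).Nonempty},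
        (Set.finite_singleton x).subset fun z hz => hz.1,
        (Set.finite_singleton y).subset fun z hz => hz.1, ?_, ?_, ?_, ?_, ?_,
        fun h => absurd h hfin⟩
      · rintro _ ⟨rfl, -⟩; exact hx
      · rintro _ ⟨rfl, -⟩; exact hy
      · exact Set.disjoint_left.2 fun z hz hz' => hxy (hz.1.symm.trans hz'.1)
      · exact ⟨fun ⟨_, h⟩ => h.2, fun h => ⟨x, rfl, h⟩⟩
      · exact ⟨fun ⟨_, h⟩ => h.2, fun h => ⟨y, rfl, h⟩⟩
    · have h0 : (V ∩ f p).encard = 0 := Set.encard_eq_zero.2 (Set.not_nonempty_iff_eq_empty.1 hne)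
      rw [hsplit, add_eq_zero, Set.encard_eq_zero, Set.encard_eq_zero] at h0
      refine ⟨∅, ∅, Set.finite_empty, Set.finite_empty, Set.empty_subset _, Set.empty_subset _,
        disjoint_bot_left, ?_, ?_, fun h => absurd h hfin⟩
      · rw [h0.1]
      · rw [h0.2]

end

section

variable {R : Type u} [NonUnitalRing R] {P : Type} {lt : P → P → Prop}
  {f : P → Set (StoneSpace R)}

open StoneSpace

/-- The extension step of the back-and-forth argument: if `U` and `V` have the same number of
points of each type, then a splitting of `U` into two open pieces is imitated by a splitting of
`V` into a compact open set and a remainder. The compactness hypothesis ensures that the points of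
`V` that must not belong to the remainder can be covered by a compact open set. -/
theorem exists_split [Finite P] (hf : IsFiniteCrowdedFamily lt f) {U₁ U₂ V : Set (StoneSpace R)}
    (hU₁ : IsOpen U₁) (hU₂ : IsOpen U₂) (hV : IsOpen V) (hdisj : Disjoint U₁ U₂)
    (hUV : ∀ p, ((U₁ ∪ U₂) ∩ f p).encard = (V ∩ f p).encard)
    (hK : ∀ p, ¬ (U₂ ∩ f p).Nonempty → IsCompact (V ∩ closure (f p))) :
    ∃ d : R, basicOpen d ⊆ V ∧ ∀ p, (basicOpen d ∩ f p).encard = (U₁ ∩ f p).encard ∧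
      ((V \ basicOpen d) ∩ f p).encard = (U₂ ∩ f p).encard := by
  choose G₁ G₂ hG₁fin hG₂fin hG₁ hG₂ hG hG₁ne hG₂ne hGfin using fun p =>
    hf.exists_representatives hV hdisj p (hUV p)
  let F₁ := ⋃ p, G₁ p
  let F₂ := ⋃ p, G₂ p
  have hF₁ : F₁.Finite := Set.finite_iUnion hG₁fin
  have hF₂ : F₂.Finite := Set.finite_iUnion hG₂fin
  have hmem₁ : ∀ {x p}, x ∈ F₁ → x ∈ f p → x ∈ G₁ p := by
    intro x p hx hxp
    obtain ⟨q, hq⟩ := Set.mem_iUnion.1 hx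
    obtain rfl := hf.eq_of_mem hxp (hG₁ q hq).2
    exact hq
  have hmem₂ : ∀ {x p}, x ∈ F₂ → x ∈ f p → x ∈ G₂ p := by
    intro x p hx hxp
    obtain ⟨q, hq⟩ := Set.mem_iUnion.1 hx
    obtain rfl := hf.eq_of_mem hxp (hG₂ q hq).2
    exact hq
  have hF : Disjoint F₁ F₂ := Set.disjoint_left.2 fun x hx hx' => by
    obtain ⟨p, hp⟩ := hf.exists_mem x
    exact Set.disjoint_left.1 (hG p) (hmem₁ hx hp) (hmem₂ hx' hp)
  let Z₁ := ⋃ p ∈ {p | ¬ (U₁ ∩ f p).Nonempty}, f p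
  let Z₂ := ⋃ p ∈ {p | ¬ (U₂ ∩ f p).Nonempty}, f p
  have hZ₁ : IsClosed Z₁ := hf.isClosed_iUnion hU₁
  have hZ₂ : IsClosed Z₂ := hf.isClosed_iUnion hU₂
  have hmemZ₁ : ∀ {x p}, x ∈ f p → (x ∈ Z₁ ↔ ¬ (U₁ ∩ f p).Nonempty) := by
    intro x p hxp
    simp only [Z₁, Set.mem_iUnion]
    refine ⟨?_, fun h => ⟨p, h, hxp⟩⟩
    rintro ⟨q, hq, hxq⟩
    rwa [hf.eq_of_mem hxp hxq]
  have hmemZ₂ : ∀ {x p}, x ∈ f p → (x ∈ Z₂ ↔ ¬ (U₂ ∩ f p).Nonempty) := by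
    intro x p hxp
    simp only [Z₂, Set.mem_iUnion]
    refine ⟨?_, fun h => ⟨p, h, hxp⟩⟩
    rintro ⟨q, hq, hxq⟩
    rwa [hf.eq_of_mem hxp hxq]
  -- `V ∩ (Z₂ ∪ F₁)` must be covered by the compact open set, which must avoid `Z₁ ∪ F₂`.
  have hcompact : IsCompact (V ∩ Z₂ ∪ F₁) := by
    refine IsCompact.union ?_ hF₁.isCompact
    have h1 : IsCompact (⋃ p ∈ {p | ¬ (U₂ ∩ f p).Nonempty}, V ∩ closure (f p)) :=
      (Set.toFinite _).isCompact_biUnion hK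
    have h2 := h1.inter_right hZ₂
    convert h2 using 1
    ext x
    simp only [Set.mem_inter_iff, Set.mem_iUnion]
    constructor
    · rintro ⟨hxV, hx⟩
      obtain ⟨p, hp, hxp⟩ := Set.mem_iUnion₂.1 hx
      exact ⟨⟨p, hp, hxV, subset_closure hxp⟩, hx⟩
    · rintro ⟨⟨p, -, hxV, -⟩, hx⟩
      exact ⟨hxV, hx⟩
  have hopen : IsOpen (V \ (Z₁ ∪ F₂)) := hV.sdiff (hZ₁.union hF₂.isClosed)
  have hsub : V ∩ Z₂ ∪ F₁ ⊆ V \ (Z₁ ∪ F₂) := by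
    intro x hx
    obtain ⟨p, hp⟩ := hf.exists_mem x
    rcases hx with ⟨hxV, hxZ⟩ | hx
    · have h2 := (hmemZ₂ hp).1 hxZ
      refine ⟨hxV, ?_⟩
      rintro (h | h)
      · have h1 := (hmemZ₁ hp).1 h
        have hne : ((U₁ ∪ U₂) ∩ f p).Nonempty := by
          rw [← Set.encard_pos, hUV, Set.encard_pos]
          exact ⟨x, hxV, hp⟩
        rw [Set.union_inter_distrib_right, Set.union_nonempty] at hne
        exact hne.elim h1 h2
      · exact h2 ((hG₂ne p).1 ⟨x, hmem₂ h hp⟩)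
    · have hxG := hmem₁ hx hp
      refine ⟨(hG₁ p hxG).1, ?_⟩
      rintro (h | h)
      · exact (hmemZ₁ hp).1 h ((hG₁ne p).1 ⟨x, hxG⟩)
      · exact Set.disjoint_left.1 hF hx h
  obtain ⟨d, hd, hd'⟩ := exists_basicOpen_subset hcompact hopen hsub
  refine ⟨d, hd'.trans Set.sdiff_subset, fun p => ?_⟩
  have hG₁d : G₁ p ⊆ basicOpen d ∩ f p := fun x hx =>
    ⟨hd (Or.inr (Set.mem_iUnion.2 ⟨p, hx⟩)), (hG₁ p hx).2⟩
  have hG₂d : G₂ p ⊆ (V \ basicOpen d) ∩ f p := fun x hx =>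
    ⟨⟨(hG₂ p hx).1, fun hxd => (hd' hxd).2 (Or.inr (Set.mem_iUnion.2 ⟨p, hx⟩))⟩, (hG₂ p hx).2⟩
  rcases hf.finite_or_crowded p with hfin | hcr
  · obtain ⟨hunion, hcard₁, hcard₂⟩ := hGfin p hfin
    rw [← hcard₁, ← hcard₂]
    constructor
    · congr 1
      refine Set.Subset.antisymm (fun x hx => ?_) hG₁d
      rcases hunion.symm.subset (⟨(hd' hx.1).1, hx.2⟩ : x ∈ V ∩ f p) with h | h
      · exact h
      · exact absurd hx.1 (hG₂d h).1.2
    · congr 1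
      refine Set.Subset.antisymm (fun x hx => ?_) hG₂d
      rcases hunion.symm.subset (⟨hx.1.1, hx.2⟩ : x ∈ V ∩ f p) with h | h
      · exact absurd (hG₁d h).1 hx.1.2
      · exact h
  · have key : ∀ O O' : Set (StoneSpace R), IsOpen O → IsOpen O' →
        ((O ∩ f p).Nonempty ↔ (O' ∩ f p).Nonempty) → (O ∩ f p).encard = (O' ∩ f p).encard := by
      intro O O' hO hO' h
      by_cases hne : (O ∩ f p).Nonempty
      · rw [hcr.encard_inter hO hne, hcr.encard_inter hO' (h.1 hne)]
      · rw [Set.not_nonempty_iff_eq_empty.1 hne,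
          Set.not_nonempty_iff_eq_empty.1 fun h' => hne (h.2 h')]
    refine ⟨key _ _ (isOpen_basicOpen d) hU₁ ⟨?_, fun h => ((hG₁ne p).2 h).mono hG₁d⟩,
      key _ _ (hV.sdiff (isClosed_basicOpen d)) hU₂ ⟨?_, fun h => ((hG₂ne p).2 h).mono hG₂d⟩⟩
    · rintro ⟨x, hxd, hxp⟩
      by_contra h
      exact (hd' hxd).2 (Or.inl ((hmemZ₁ hxp).2 h))
    · rintro ⟨x, ⟨hxV, hxd⟩, hxp⟩
      by_contra h
      exact hxd (hd (Or.inl ⟨hxV, (hmemZ₂ hxp).2 h⟩))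

end

end IsFiniteCrowdedFamily

/-! ### Invariants of tuples -/

namespace StoneSpace

section

variable {R : Type u} [NonUnitalRing R] {k : ℕ}

/-- The cell of the tuple `a` with label `σ`: the points at which `a` takes the value `σ`. The
cells of `a` are the atoms of the algebra generated by the basic open sets of its entries,
together with the complement of their union. -/
def cell (a : Fin k → R) (σ : Fin k → ZMod 2) : Set (StoneSpace R) :=
  {x | ∀ i, x.1 (a i) = σ i}

theorem isClopen_cell (a : Fin k → R) (σ : Fin k → ZMod 2) : IsClopen (cell a σ) := by
  have : cell a σ = ⋂ i, {x | x.1 (a i) = σ i} := by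
    ext x
    simp [cell]
  rw [this]
  refine isClopen_iInter_of_finite fun i => ?_
  rcases zmod_two_cases (σ i) with h | h
  · rw [h]
    have : {x : StoneSpace R | x.1 (a i) = 0} = (basicOpen (a i))ᶜ :=
      Set.ext fun x => apply_eq_zero_iff
    rw [this]
    exact ⟨(isOpen_basicOpen _).isClosed_compl, (isClosed_basicOpen _).isOpen_compl⟩
  · rw [h]
    exact ⟨isClosed_basicOpen (a i), isOpen_basicOpen (a i)⟩

theorem eq_of_mem_cell {a : Fin k → R} {σ τ : Fin k → ZMod 2} {x : StoneSpace R}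
    (hσ : x ∈ cell a σ) (hτ : x ∈ cell a τ) : σ = τ :=
  funext fun i => (hσ i).symm.trans (hτ i)

theorem cell_snoc (a : Fin k → R) (c : R) (τ : Fin (k + 1) → ZMod 2) :
    cell (Fin.snoc a c : Fin (k + 1) → R) τ =
      cell a (τ ∘ Fin.castSucc) ∩ {x | x.1 c = τ (Fin.last k)} := by
  ext x
  simp [cell, Fin.forall_fin_succ']

/-- The value of a term at a point of the Stone space depends only on the values of its
variables. -/
theorem exists_apply_realize_eq {n : ℕ} (J : Fin n → TwoSidedIdeal R)
    (t : (idealLanguage n).Term (Fin k)) : ∃ g : (Fin k → ZMod 2) → ZMod 2,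
      ∀ (x : StoneSpace R) (a : Fin k → R),
        letI := idealStructure J
        x.1 (t.realize a) = g fun i => x.1 (a i) := by
  let _ := idealStructure J
  induction t with
  | var i => exact ⟨fun σ => σ i, fun _ _ => rfl⟩
  | func F ts ih =>
    choose g hg using ih
    cases F with
    | zero => exact ⟨fun _ => 0, fun x _ => map_zero x.1⟩
    | neg => exact ⟨fun σ => -g 0 σ, fun x a => (map_neg x.1 _).trans (congrArg _ (hg 0 x a))⟩
    | add => exact ⟨fun σ => g 0 σ + g 1 σ, fun x a =>
        (map_add x.1 _ _).trans (congrArg₂ _ (hg 0 x a) (hg 1 x a))⟩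
    | mul => exact ⟨fun σ => g 0 σ * g 1 σ, fun x a =>
        (map_mul x.1 _ _).trans (congrArg₂ _ (hg 0 x a) (hg 1 x a))⟩

variable {P : Type}

/-- The invariant of a tuple: the number of points of each type in each of its cells. -/
noncomputable def invariant (f : P → Set (StoneSpace R)) (k : ℕ) (a : Fin k → R) :
    (Fin k → ZMod 2) → P → ℕ∞ :=
  fun σ p => (cell a σ ∩ f p).encard

end

end StoneSpace

open StoneSpace

namespace IsFiniteCrowdedFamily

variable {R : Type u} [NonUnitalRing R] {P : Type} {lt : P → P → Prop}
  {f : P → Set (StoneSpace R)}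

theorem finite_range_invariant [Finite P] (hf : IsFiniteCrowdedFamily lt f) (k : ℕ) :
    (Set.range (invariant f k)).Finite := by
  have hval : ∀ p, ∃ V : Set ℕ∞, V.Finite ∧ ∀ O : Set (StoneSpace R), IsOpen O →
      (O ∩ f p).encard ∈ V := by
    intro p
    rcases hf.finite_or_crowded p with hfin | hcr
    · exact ⟨_, hfin.finite_subsets.image Set.encard, fun O _ => ⟨_, Set.inter_subset_right, rfl⟩⟩
    · refine ⟨{0, ⊤}, Set.toFinite _, fun O hO => ?_⟩
      by_cases hne : (O ∩ f p).Nonempty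
      · exact Or.inr (hcr.encard_inter hO hne)
      · exact Or.inl (Set.encard_eq_zero.2 (Set.not_nonempty_iff_eq_empty.1 hne))
  choose V hV hmem using hval
  refine (Set.Finite.pi' fun _ => Set.Finite.pi' hV).subset ?_
  rintro _ ⟨a, rfl⟩ σ p
  exact hmem p _ (isClopen_cell a σ).isOpen

theorem exists_invariant_snoc_eq [Finite P] (hf : IsFiniteCrowdedFamily lt f) {k : ℕ}
    {a b : Fin k → R} (hab : invariant f k a = invariant f k b) (c : R) :
    ∃ d, invariant f (k + 1) (Fin.snoc a c) = invariant f (k + 1) (Fin.snoc b d) := by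
  have hsplit : ∀ σ : Fin k → ZMod 2, ∃ d : R, basicOpen d ⊆ cell b σ ∧ ∀ p,
      (basicOpen d ∩ f p).encard = (cell a σ ∩ basicOpen c ∩ f p).encard ∧
      ((cell b σ \ basicOpen d) ∩ f p).encard = (cell a σ \ basicOpen c ∩ f p).encard := by
    intro σ
    refine hf.exists_split ((isClopen_cell a σ).isOpen.inter (isOpen_basicOpen c))
      ((isClopen_cell a σ).isOpen.sdiff (isClosed_basicOpen c)) (isClopen_cell b σ).isOpen
      (Set.disjoint_left.2 fun x hx hx' => hx'.2 hx.2) (fun p => ?_) fun p hp => ?_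
    · rw [Set.inter_union_sdiff]
      exact congrFun (congrFun hab σ) p
    · by_cases hσ : ∃ i, σ i = 1
      · obtain ⟨i, hi⟩ := hσ
        refine (isCompact_basicOpen (b i)).of_isClosed_subset
          ((isClopen_cell b σ).isClosed.inter isClosed_closure) ?_
        rintro x ⟨hx, -⟩
        exact (hx i).trans hi
      · -- Outside all the basic open sets of `a`, the points of type `p` lie in `basicOpen c`.
        have hcomp : IsCompact ((⋃ i, basicOpen (a i)) ∪ basicOpen c) :=
          (isCompact_iUnion fun i => isCompact_basicOpen (a i)).union (isCompact_basicOpen c)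
        have hsub : f p ⊆ (⋃ i, basicOpen (a i)) ∪ basicOpen c := by
          intro x hx
          by_contra hcon
          rw [Set.mem_union, Set.mem_iUnion, not_or, not_exists] at hcon
          refine hp ⟨x, ⟨fun i => ?_, hcon.2⟩, hx⟩
          rw [(zmod_two_cases (σ i)).resolve_right fun h => hσ ⟨i, h⟩]
          exact apply_eq_zero_iff.2 (hcon.1 i)
        exact (hcomp.closure_of_subset hsub).inter_left (isClopen_cell b σ).isClosed
  choose d hd hcard using hsplit
  obtain ⟨e, he⟩ := exists_eq_basicOpen
    (isCompact_iUnion fun σ => isCompact_basicOpen (d σ))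
    (isOpen_iUnion fun σ => isOpen_basicOpen (d σ))
  have hcell : ∀ σ, cell b σ ∩ basicOpen e = basicOpen (d σ) := by
    intro σ
    rw [← he]
    refine Set.Subset.antisymm ?_ fun x hx => ⟨hd σ hx, Set.mem_iUnion.2 ⟨σ, hx⟩⟩
    rintro x ⟨hx, hx'⟩
    obtain ⟨τ, hτ⟩ := Set.mem_iUnion.1 hx'
    rwa [eq_of_mem_cell hx (hd τ hτ)]
  refine ⟨e, funext fun τ => funext fun p => ?_⟩
  have h1 := hcard (τ ∘ Fin.castSucc) p
  simp only [invariant, cell_snoc]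
  have hzero : ∀ r : R, {x : StoneSpace R | x.1 r = 0} = (basicOpen r)ᶜ := fun r =>
    Set.ext fun x => apply_eq_zero_iff
  have hone : ∀ r : R, {x : StoneSpace R | x.1 r = 1} = basicOpen r := fun r => rfl
  rcases zmod_two_cases (τ (Fin.last k)) with h | h
  · rw [h, hzero, hzero, ← Set.sdiff_eq, ← Set.sdiff_eq, ← h1.2, ← hcell, Set.sdiff_self_inter]
  · rw [h, hone, hone, hcell, h1.1]

/-- Tuples with the same invariant have nonempty cells of the same labels and types. -/
theorem exists_mem_of_invariant_eq {k : ℕ} {a b : Fin k → R}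
    (hab : invariant f k a = invariant f k b) {x : StoneSpace R} {p : P} (hx : x ∈ f p) :
    ∃ y ∈ f p, ∀ i, y.1 (a i) = x.1 (b i) := by
  have hne : (cell b (fun i => x.1 (b i)) ∩ f p).Nonempty := ⟨x, fun _ => rfl, hx⟩
  have h : (cell a (fun i => x.1 (b i)) ∩ f p).encard =
      (cell b (fun i => x.1 (b i)) ∩ f p).encard := congrFun (congrFun hab _) p
  rw [← Set.encard_pos, ← h, Set.encard_pos] at hne
  obtain ⟨y, hy, hyp⟩ := hne
  exact ⟨y, hyp, hy⟩

theorem isOmegaCategoricalSystem [Countable R] (hR : ∀ a : R, a * a = a) [Finite P]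
    (hf : IsFiniteCrowdedFamily lt f) {n : ℕ} {J : Fin n → TwoSidedIdeal R}
    (hJ : ∀ i p, f p ⊆ closedSet (J i) ∨ Disjoint (f p) (closedSet (J i))) :
    IsOmegaCategoricalSystem J := by
  let _ := idealStructure J
  refine isOmegaCategorical_of_invariant (L := idealLanguage n) (M := R) (invariant f)
    hf.finite_range_invariant (fun k a b hab c => hf.exists_invariant_snoc_eq hab c) ?_ ?_
  · intro k a b hab t₁ t₂ h
    obtain ⟨g₁, hg₁⟩ := exists_apply_realize_eq J t₁
    obtain ⟨g₂, hg₂⟩ := exists_apply_realize_eq J t₂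
    refine basicOpen_injective hR (Set.ext fun x => ?_)
    obtain ⟨p, hp⟩ := hf.exists_mem x
    obtain ⟨y, -, hy⟩ := exists_mem_of_invariant_eq hab hp
    rw [mem_basicOpen, mem_basicOpen, hg₁, hg₂, ← funext hy, ← hg₁, ← hg₂, h]
  · intro k a b hab l r t h
    cases r with
    | ideal i =>
      obtain ⟨g, hg⟩ := exists_apply_realize_eq J (t 0)
      have h' : (t 0).realize a ∈ J i := h
      change (t 0).realize b ∈ J i
      rw [mem_iff_disjoint_closedSet hR] at h' ⊢
      refine Set.disjoint_left.2 fun x hx hxJ => ?_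
      obtain ⟨p, hp⟩ := hf.exists_mem x
      obtain ⟨y, hyp, hy⟩ := exists_mem_of_invariant_eq hab hp
      have hyJ := ((hJ i p).resolve_right fun h => Set.disjoint_left.1 h hp hxJ) hyp
      refine Set.disjoint_left.1 h' ?_ hyJ
      rw [mem_basicOpen, hg] at hx ⊢
      rwa [funext hy]

end IsFiniteCrowdedFamily

theorem IsCompletePartition.exists_isFiniteCrowdedFamily {X : Type u} [TopologicalSpace X]
    {P : Type} {po : POSystem P} {𝒳 : Set (Set X)} (h : IsCompletePartition po 𝒳)
    (hfc : IsFiniteCrowdedPartition 𝒳) :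
    ∃ f : P → Set X, Set.range f = 𝒳 ∧ IsFiniteCrowdedFamily po.lt f := by
  obtain ⟨hpart, f, hinj, rfl, hf⟩ := h
  refine ⟨f, rfl, ⟨fun {p q x} hp hq => hinj ?_, fun x => ?_, hf, fun p => hfc.2.2 _ ⟨p, rfl⟩⟩⟩
  · exact (hpart.2 x).unique ⟨⟨p, rfl⟩, hp⟩ ⟨⟨q, rfl⟩, hq⟩
  · obtain ⟨_, ⟨⟨p, rfl⟩, hp⟩, -⟩ := hpart.2 x
    exact ⟨p, hp⟩

theorem theorem1p1 {R : Type u} [NonUnitalRing R] [Countable R]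
    (hR : ∀ a : R, a * a = a) (n : ℕ) (J : Fin n → TwoSidedIdeal R)
    (C : Fin n → Set (StoneSpace R)) (hC : ∀ i, C i = StoneSpace.closedSet (J i)) :
    List.TFAE [
      IsOmegaCategoricalSystem J,
      (closureSubalgebra (Set.range C) : Set (Set (StoneSpace R))).Finite ∧
        ∀ S ∈ atomSet (closureSubalgebra (Set.range C)), (isolatedPoints S).Finite,
      (derivedSubalgebra (Set.range C) : Set (Set (StoneSpace R))).Finite ∧
        IsFiniteCrowdedPartition (atomSet (derivedSubalgebra (Set.range C))),
      ∃ (P : Type) (_ : Finite P) (po : POSystem P),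
        IsFiniteCrowdedPartition (atomSet (derivedSubalgebra (Set.range C))) ∧
        IsCompletePartition po (atomSet (derivedSubalgebra (Set.range C))),
      ∃ (P : Type) (_ : Finite P) (po : POSystem P) (𝒳 : Set (Set (StoneSpace R))),
        IsFiniteCrowdedPartition 𝒳 ∧ IsCompletePartition po 𝒳 ∧ PartitionRefines 𝒳 C] := by
  tfae_have 1 → 2 := by
    intro h
    obtain ⟨hfin, hdef⟩ := closureSubalgebra_finite_of_isOmegaCategoricalSystem hR h hC
    exact ⟨hfin, fun S hS => finite_isolatedPoints_of_isOmegaCategoricalSystem h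
      (hdef S (mem_atomSet_iff.1 hS).1)⟩
  tfae_have 2 → 3 := fun h => finite_derivedSubalgebra_of_closureSubalgebra h.1 h.2
  tfae_have 3 → 4 := by
    rintro ⟨hfin, hfc⟩
    have hclosed : ∀ S ∈ Set.range C, IsClosed S := by
      rintro _ ⟨i, rfl⟩
      rw [hC]
      exact isClosed_closedSet _
    obtain ⟨P, hP, po, h⟩ := exists_isCompletePartition_atomSet hclosed hfin
    exact ⟨P, hP, po, hfc, h⟩
  tfae_have 4 → 5 := by
    rintro ⟨P, hP, po, hfc, h⟩
    exact ⟨P, hP, po, _, hfc, h, partitionRefines_atomSet hfc.1⟩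
  tfae_have 5 → 1 := by
    rintro ⟨P, hP, po, 𝒳, hfc, h, href⟩
    obtain ⟨f, rfl, hf⟩ := h.exists_isFiniteCrowdedFamily hfc
    refine hf.isOmegaCategoricalSystem hR fun i p => ?_
    obtain ⟨𝒬, h𝒬, hi⟩ := href i
    rw [← hC]
    exact hfc.1.mem_saturatedSubalgebra_of_eq_sUnion h𝒬 hi _ ⟨p, rfl⟩
  tfae_finish
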